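/- \textbf{Conventions.} A \emph{dispace} $\mathcal X=(X,dX)$ is a topological space with a set $dX$ of paths $[0,1]\to X$ that contains the constant paths and is closed under precomposition with continuous non-decreasing maps $[0,1]\to[0,1]$ and under concatenation; a morphism is a continuous map preserving these dipaths. The trace space $\overrightarrow{T}(\mathcal X)(x,y)$ is the space of dipaths from $x$ to $y$ (compact-open topology) modulo non-decreasing reparametrization fixing the endpoints of $[0,1]$, with the quotient topology. The trace category $\mathbf P(\mathcal X)$ has the points of $X$ as objects and traces as morphisms. The factorization category $F\mathcal C$ of a category $\mathcal C$ has the morphisms of $\mathcal C$ as objects, and pairs $(u,v)$ with $ufv=f'$ as morphisms $f\to f'$; a natural system on $\mathcal C$ with values in $\mathcal V$ is a functor $F\mathcal C\to\mathcal V$. $\mathbf{Act}$ is the category of pointed sets $(X,0_X)$ with a right action of a group $G$ (base point not assumed fixed). Pointed sets embed in it with the trivial group acting, groups embed by right multiplication on themselves. The kernel of $f=(f',f''):(X,G)\to(Y,H)$ is $\bigl(f'^{-1}(0_Y),\,f''^{-1}(\mathrm{Stab}_H(0_Y))\bigr)$, its cokernel is $(Y/R,H)$ with $R$ the smallest $H$-invariant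 equivalence relation identifying every point of $f'(X)$ with $0_Y$, and $A\xrightarrow{f}B\xrightarrow{g}C$ is exact if $\ker(\mathrm{cok} f)=\ker g$. Sequences of natural systems of actions are exact when they are so at each object. For a dispace $\mathcal X$, $n\ge1$ and a trace $e:x\to y$, put $P_n(\mathcal X)_e=\pi_{n-1}(\overrightarrow{T}(\mathcal X)(x,y),e)$. For a morphism $p:E\to B$ of dispaces and a trace $e:x\to y$ of $E$, let $\overrightarrow p_e:\overrightarrow T(E)(x,y)\to\overrightarrow T(B)(p(x),p(y))$ be the induced map, $\overrightarrow T(E)_e=\overrightarrow T(E)(x,y)$, $\overrightarrow T(B)_{p(e)}=\overrightarrow T(B)(p(x),p(y))$ and $\overrightarrow T(F)_e=\overrightarrow p_e^{-1}(p(e))$, pointed at $e$. Put $P_n(F)_e=\pi_{n-1}(\overrightarrow T(F)_e,e)$ and $P_n(E,F)_e=\pi_{n-1}(\overrightarrow T(E)_e,\overrightarrow T(F)_e,e)$, where the relative $\pi_k$ is a group for $k\ge2$, $\pi_1(X,A)$ is a pointed set on which $\pi_1(X)$ acts by concatenation, and $\pi_0(X,A)$ is the cokernel of $\pi_0(A)\to\pi_0(X)$.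 These, and $(p^*P_n(B))_e=P_n(B)_{p(e)}$, are natural systems on $\mathbf P(E)$. \textbf{Theorem.} Let $p:E\to B$ be a morphism of dispaces such that $\overrightarrow p_e$ is a Serre fibration for every trace $e$ of $E$. Then there is a long exact sequence of natural systems of actions on $\mathbf P(E)$ $$\cdots\to P_n(F)\to P_n(E)\to P_n(E,F)\xrightarrow{\partial}P_{n-1}(F)\to\cdots\to P_2(F)\to P_2(E)\to(P_2(E,F),P_2(E))\to P_1(F)\to P_1(E)\to P_1(E,F)\to0,$$ whose maps are induced by the inclusions and by restriction to the distinguished face of the cube ($\partial$). Moreover the morphism induced by $p$ is an isomorphism $P_n(E,F)\cong p^*P_n(B)$ for all $n\ge2$: of natural systems of groups for $n\ge3$ and of pointed sets for $n=2$. If $\overrightarrow T(B)_{p(e)}$ is path connected for every trace $e$ of $E$, the induced morphism is also an isomorphism for $n=1$ (of pointed sets). -/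

import Mathlib

open CategoryTheory unitInterval Topology

universe u

namespace DirectedHomotopy

noncomputable section

/-! ### Actions -/

/-- An action: a pointed set with a right action of a group (the base point need not be fixed). -/
structure ActCat : Type (u + 1) where
  pts : Type u
  grp : Type u
  [group : Group grp]
  zero : pts
  act : pts → grp → pts
  act_one : ∀ x, act x 1 = x
  act_mul : ∀ x g h, act x (g * h) = act (act x g) h

namespace ActCat

attribute [instance] ActCat.group

@[ext]
structure Hom (A B : ActCat.{u}) : Type u where
  fn : A.pts → B.pts
  hom : A.grp →* B.grp
  map_zero : fn A.zero = B.zero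
  map_act : ∀ x g, fn (A.act x g) = B.act (fn x) (hom g)

instance : Category ActCat.{u} where
  Hom := Hom
  id A := ⟨id, MonoidHom.id _, rfl, fun _ _ => rfl⟩
  comp f g := ⟨g.fn ∘ f.fn, g.hom.comp f.hom,
    by simp [f.map_zero, g.map_zero], fun x h => by simp [f.map_act, g.map_act]⟩

@[ext]
theorem hom_ext {A B : ActCat.{u}} {f g : A ⟶ B} (h₁ : f.fn = g.fn) (h₂ : f.hom = g.hom) : f = g :=
  Hom.ext h₁ h₂

@[simp] theorem id_fn (A : ActCat.{u}) (x : A.pts) : Hom.fn (𝟙 A) x = x := rfl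
@[simp] theorem id_hom (A : ActCat.{u}) (x : A.grp) : Hom.hom (𝟙 A) x = x := rfl
@[simp] theorem comp_fn {A B C : ActCat.{u}} (f : A ⟶ B) (g : B ⟶ C) (x : A.pts) :
    (f ≫ g).fn x = g.fn (f.fn x) := rfl
@[simp] theorem comp_hom {A B C : ActCat.{u}} (f : A ⟶ B) (g : B ⟶ C) (x : A.grp) :
    (f ≫ g).hom x = g.hom (f.hom x) := rfl

/-- The underlying pointed set of an action. -/
@[simps] def points : ActCat.{u} ⥤ Pointed.{u} where
  obj A := ⟨A.pts, A.zero⟩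
  map f := ⟨f.fn, f.map_zero⟩

/-- The embedding of pointed sets: the trivial group acts. -/
@[simps] def ofPointed (X : Type u) (x : X) : ActCat.{u} where
  pts := X
  grp := PUnit
  zero := x
  act y _ := y
  act_one _ := rfl
  act_mul _ _ _ := rfl

/-- The embedding of groups: a group acts on its underlying set by right multiplication. -/
@[simps] def ofGroup (G : Type u) [Group G] : ActCat.{u} where
  pts := G
  grp := G
  zero := 1
  act x g := x * g
  act_one := mul_one
  act_mul x g h := (mul_assoc x g h).symm

/-- A pointed map, as a morphism of actions. -/
@[simps] def ofPointedHom {X Y : Type u} {x : X} {y : Y} (f : X → Y) (h : f x = y) :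
    ofPointed X x ⟶ ofPointed Y y where
  fn := f
  hom := 1
  map_zero := h
  map_act _ _ := rfl

/-- A group homomorphism, as a morphism of actions. -/
@[simps] def ofGroupHom {G H : Type u} [Group G] [Group H] (f : G →* H) :
    ofGroup G ⟶ ofGroup H where
  fn := f
  hom := f
  map_zero := f.map_one
  map_act := f.map_mul

/-- The null action: the one-point set with the trivial group. -/
def null : ActCat.{u} := ofPointed PUnit PUnit.unit

/-- The unique morphism to the null action. -/
def toNull (A : ActCat.{u}) : A ⟶ null where
  fn _ := PUnit.unit
  hom := 1
  map_zero := rfl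
  map_act _ _ := rfl

/-- The subgroup of elements that fix the base point. -/
def fix (A : ActCat.{u}) : Subgroup A.grp where
  carrier := {g | A.act A.zero g = A.zero}
  one_mem' := A.act_one _
  mul_mem' {g h} hg hh := by
    change A.act A.zero (g * h) = A.zero
    rw [A.act_mul, show A.act A.zero g = A.zero from hg, show A.act A.zero h = A.zero from hh]
  inv_mem' {g} hg := by
    calc A.act A.zero g⁻¹ = A.act (A.act A.zero g) g⁻¹ := by rw [show A.act A.zero g = A.zero from hg]
      _ = A.zero := by rw [← A.act_mul, mul_inv_cancel, A.act_one]

/-- A subset of the points together with a subgroup of the group. -/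
@[ext]
structure Sub (A : ActCat.{u}) where
  pts : Set A.pts
  grp : Subgroup A.grp

/-- The kernel of a morphism of actions: the preimage of the base point, with the preimage
of the stabilizer of the base point. -/
def ker {A B : ActCat.{u}} (f : A ⟶ B) : Sub A where
  pts := f.fn ⁻¹' {B.zero}
  grp := B.fix.comap f.hom

/-- The relation that generates, as an equivalence relation, the smallest congruence of the
action `B` which identifies all the points of the image of `f` with the base point. -/
def cokRel {A B : ActCat.{u}} (f : A ⟶ B) (y y' : B.pts) : Prop :=
  ∃ x h, y = B.act (f.fn x) h ∧ y' = B.act B.zero h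

/-- The cokernel of a morphism of actions (with respect to the ideal of null morphisms, those
which send every point to the base point). -/
def cok {A B : ActCat.{u}} (f : A ⟶ B) : ActCat.{u} where
  pts := Quot (cokRel f)
  grp := B.grp
  zero := Quot.mk _ B.zero
  act y g := Quot.map (fun z => B.act z g)
    (by
      rintro _ _ ⟨x, h, rfl, rfl⟩
      exact ⟨x, h * g, (B.act_mul _ _ _).symm, (B.act_mul _ _ _).symm⟩) y
  act_one := by rintro ⟨y⟩; exact congrArg (Quot.mk _) (B.act_one y)
  act_mul := by rintro ⟨y⟩ g h; exact congrArg (Quot.mk _) (B.act_mul y g h)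

/-- The projection onto the cokernel. -/
def cokProj {A B : ActCat.{u}} (f : A ⟶ B) : B ⟶ cok f where
  fn := Quot.mk _
  hom := MonoidHom.id _
  map_zero := rfl
  map_act _ _ := rfl

theorem cokProj_fn_apply {A B : ActCat.{u}} (f : A ⟶ B) (x : A.pts) :
    (cokProj f).fn (f.fn x) = (cok f).zero :=
  Quot.sound ⟨x, 1, (B.act_one _).symm, (B.act_one _).symm⟩

/-- The universal property of the cokernel. -/
def cokDesc {A B C : ActCat.{u}} (f : A ⟶ B) (g : B ⟶ C) (w : ∀ x, g.fn (f.fn x) = C.zero) :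
    cok f ⟶ C where
  fn := Quot.lift g.fn (by
    rintro _ _ ⟨x, h, rfl, rfl⟩
    rw [g.map_act, g.map_act, w, g.map_zero])
  hom := g.hom
  map_zero := g.map_zero
  map_act := by rintro ⟨x⟩ h; exact g.map_act x h

/-- The map induced on cokernels by a commutative square. -/
def cokMap {A B A' B' : ActCat.{u}} (f : A ⟶ B) (f' : A' ⟶ B') (a : A ⟶ A') (b : B ⟶ B')
    (w : f ≫ b = a ≫ f') : cok f ⟶ cok f' :=
  cokDesc f (b ≫ cokProj f') (fun x => by
    have h : b.fn (f.fn x) = f'.fn (a.fn x) := congrFun (congrArg Hom.fn w) x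
    rw [comp_fn, h, cokProj_fn_apply])

/-- The normal image of a morphism: the kernel of its cokernel. -/
def nim {A B : ActCat.{u}} (f : A ⟶ B) : Sub B := ker (cokProj f)

/-- Exactness at the middle object. -/
def Exact {A B C : ActCat.{u}} (f : A ⟶ B) (g : B ⟶ C) : Prop := nim f = ker g

end ActCat

/-! ### Pointed spaces and pointed pairs -/

/-- Pointed topological spaces. -/
structure PtTop : Type (u + 1) where
  carrier : Type u
  [top : TopologicalSpace carrier]
  pt : carrier

attribute [instance] PtTop.top

namespace PtTop

@[ext]
structure Hom (X Y : PtTop.{u}) : Type u where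
  toMap : C(X.carrier, Y.carrier)
  map_pt : toMap X.pt = Y.pt

instance : Category PtTop.{u} where
  Hom := Hom
  id X := ⟨ContinuousMap.id _, rfl⟩
  comp f g := ⟨g.toMap.comp f.toMap, by simp [f.map_pt, g.map_pt]⟩

end PtTop

/-- Pointed pairs of topological spaces: a space, a subspace, and a base point in the subspace. -/
structure PtPair : Type (u + 1) where
  carrier : Type u
  [top : TopologicalSpace carrier]
  sub : Set carrier
  pt : carrier
  pt_mem : pt ∈ sub

attribute [instance] PtPair.top

namespace PtPair

@[ext]
structure Hom (P Q : PtPair.{u}) : Type u where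
  toMap : C(P.carrier, Q.carrier)
  map_sub : ∀ x ∈ P.sub, toMap x ∈ Q.sub
  map_pt : toMap P.pt = Q.pt

instance : Category PtPair.{u} where
  Hom := Hom
  id P := ⟨ContinuousMap.id _, fun _ h => h, rfl⟩
  comp f g := ⟨g.toMap.comp f.toMap, fun x h => g.map_sub _ (f.map_sub x h),
    by simp [f.map_pt, g.map_pt]⟩

/-- The pointed space `(X, x)` of a pointed pair `(X, A, x)`. -/
@[simps] def total : PtPair.{u} ⥤ PtTop.{u} where
  obj P := ⟨P.carrier, P.pt⟩
  map f := ⟨f.toMap, f.map_pt⟩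

/-- The pointed space `(A, x)` of a pointed pair `(X, A, x)`. -/
@[simps] def subspace : PtPair.{u} ⥤ PtTop.{u} where
  obj P := ⟨P.sub, ⟨P.pt, P.pt_mem⟩⟩
  map f := ⟨⟨fun x => ⟨f.toMap x, f.map_sub x x.2⟩, by fun_prop⟩, Subtype.ext f.map_pt⟩

/-- The inclusion of the subspace. -/
@[simps] def incl : subspace.{u} ⟶ total.{u} where
  app _ := ⟨⟨Subtype.val, continuous_subtype_val⟩, rfl⟩

/-- The pointed pair `(B, {b}, b)` of a pointed space `(B, b)`. -/
@[simps] def ofPtTop : PtTop.{u} ⥤ PtPair.{u} where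
  obj B := ⟨B.carrier, {B.pt}, B.pt, rfl⟩
  map f := ⟨f.toMap, by rintro _ rfl; exact f.map_pt, f.map_pt⟩

end PtPair

/-! ### Homotopy groups -/

section Cubes

variable {X Y : Type u} [TopologicalSpace X] [TopologicalSpace Y]

/-- The concatenation of two maps on a cube along the first coordinate. -/
def concatFun {n : ℕ} {X : Type u} (f g : (I^(Fin (n + 1))) → X) : (I^(Fin (n + 1))) → X :=
  fun t => if (t 0 : ℝ) ≤ 1 / 2
    then f (Function.update t 0 (Set.projIcc 0 1 zero_le_one (2 * (t 0 : ℝ))))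
    else g (Function.update t 0 (Set.projIcc 0 1 zero_le_one (2 * (t 0 : ℝ) - 1)))

theorem comp_concatFun {n : ℕ} {X Y : Type u} (φ : X → Y) (f g : (I^(Fin (n + 1))) → X)
    (t : I^(Fin (n + 1))) : φ (concatFun f g t) = concatFun (φ ∘ f) (φ ∘ g) t := by
  simp only [concatFun, apply_ite φ, Function.comp]

/-- Mathlib's product in `π_ (n + 1)` reads loops from right to left. The group used here is
its opposite, in which the product of the classes of `f` and `g` is the class of
`f` followed by `g`. -/
abbrev PiGrp (n : ℕ) (X : Type u) [TopologicalSpace X] (x : X) : Type u := (π_ (n + 1) X x)ᵐᵒᵖ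

/-- The class of a cube whose boundary is sent to the base point. -/
def PiGrp.mk {n : ℕ} {x : X} (f : GenLoop (Fin (n + 1)) X x) : PiGrp n X x :=
  MulOpposite.op (Quotient.mk _ f)

theorem PiGrp.ind {n : ℕ} {x : X} {P : PiGrp n X x → Prop} (h : ∀ f, P (PiGrp.mk f)) (a) : P a := by
  obtain ⟨⟨f⟩⟩ := a
  exact h f

theorem PiGrp.mk_eq {n : ℕ} {x : X} {f g : GenLoop (Fin (n + 1)) X x} :
    PiGrp.mk f = PiGrp.mk g ↔ GenLoop.Homotopic f g := by
  exact MulOpposite.op_injective.eq_iff.trans Quotient.eq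

theorem PiGrp.mk_mul {n : ℕ} {x : X} (f g h : GenLoop (Fin (n + 1)) X x)
    (e : ∀ t, h t = concatFun f g t) : PiGrp.mk f * PiGrp.mk g = PiGrp.mk h := by
  have h' : h = GenLoop.transAt 0 f g := by ext t; exact e t
  subst h'
  exact congrArg MulOpposite.op (HomotopyGroup.mul_spec (i := 0) (p := g) (q := f))

theorem PiGrp.one_eq {n : ℕ} {x : X} : (1 : PiGrp n X x) = PiGrp.mk GenLoop.const := rfl

theorem PiGrp.mk_mul' {n : ℕ} {x : X} (f g : GenLoop (Fin (n + 1)) X x) :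
    PiGrp.mk f * PiGrp.mk g = PiGrp.mk (GenLoop.transAt 0 f g) :=
  PiGrp.mk_mul f g _ (fun _ => rfl)

/-- Postcomposition of cubes with a pointed map. -/
def genLoopMap {N : Type} {x : X} {y : Y} (φ : C(X, Y)) (h : φ x = y) (f : GenLoop N X x) :
    GenLoop N Y y :=
  ⟨φ.comp f.1, fun t ht => by rw [ContinuousMap.comp_apply, f.2 t ht, h]⟩

theorem genLoopMap_homotopic {N : Type} {x : X} {y : Y} (φ : C(X, Y)) (h : φ x = y)
    {f g : GenLoop N X x} (H : GenLoop.Homotopic f g) :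
    GenLoop.Homotopic (genLoopMap φ h f) (genLoopMap φ h g) :=
  ContinuousMap.HomotopicRel.comp_continuousMap H φ

/-- The homomorphism of homotopy groups induced by a pointed map. -/
def PiGrp.map {n : ℕ} {x : X} {y : Y} (φ : C(X, Y)) (h : φ x = y) : PiGrp n X x →* PiGrp n Y y :=
  MonoidHom.mk' (fun a => MulOpposite.op (Quotient.map (genLoopMap φ h)
      (fun _ _ H => genLoopMap_homotopic φ h H) a.unop)) (by
    intro a b
    induction a using PiGrp.ind with | h f => ?_
    induction b using PiGrp.ind with | h g => ?_
    rw [PiGrp.mk_mul']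
    exact (PiGrp.mk_mul (genLoopMap φ h f) (genLoopMap φ h g) _
      (fun t => comp_concatFun φ f g t)).symm)

@[simp] theorem PiGrp.map_mk {n : ℕ} {x : X} {y : Y} (φ : C(X, Y)) (h : φ x = y)
    (f : GenLoop (Fin (n + 1)) X x) : PiGrp.map φ h (PiGrp.mk f) = PiGrp.mk (genLoopMap φ h f) :=
  rfl

end Cubes
/-- The map of sets of path components induced by a continuous map. -/
def pi0Map {X Y : Type u} [TopologicalSpace X] [TopologicalSpace Y] (φ : C(X, Y)) :
    ZerothHomotopy X → ZerothHomotopy Y :=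
  Quotient.map φ (fun _ _ h => h.map φ.continuous)

/-- The homotopy functors with values in actions: `π₀` is a pointed set, `π_k` is a group for
`k ≥ 1`. -/
def piFun : ℕ → (PtTop.{u} ⥤ ActCat.{u})
  | 0 =>
    { obj := fun X => ActCat.ofPointed (ZerothHomotopy X.carrier) (ZerothHomotopy.mk X.pt)
      map := fun f => ActCat.ofPointedHom (pi0Map f.toMap) (congrArg ZerothHomotopy.mk f.map_pt)
      map_id := by
        intro X; apply ActCat.hom_ext
        · funext a; obtain ⟨a⟩ := a; rfl
        · rfl
      map_comp := by
        intro X Y Z f g; apply ActCat.hom_ext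
        · funext a; obtain ⟨a⟩ := a; rfl
        · rfl }
  | k + 1 =>
    { obj := fun X => ActCat.ofGroup (PiGrp k X.carrier X.pt)
      map := fun f => ActCat.ofGroupHom (PiGrp.map f.toMap f.map_pt)
      map_id := by
        intro X; apply ActCat.hom_ext
        · funext a; induction a using PiGrp.ind with | h a => rfl
        · ext a; induction a using PiGrp.ind with | h a => rfl
      map_comp := by
        intro X Y Z f g; apply ActCat.hom_ext
        · funext a; induction a using PiGrp.ind with | h a => rfl
        · ext a; induction a using PiGrp.ind with | h a => rfl }

/-! ### Relative homotopy -/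

namespace PtPair

section RelLoops

variable (P : PtPair.{u}) (n : ℕ)

/-- The union `J` of the faces of the cube `I^(n+1)` other than the distinguished face, on which
the last coordinate is `0`. -/
def jFace (n : ℕ) : Set (I^(Fin (n + 1))) :=
  {t | t (Fin.last n) = 1 ∨ ∃ i, i ≠ Fin.last n ∧ (t i = 0 ∨ t i = 1)}

/-- Maps of triples `(I^(n+1), ∂I^(n+1), J) → (X, A, x)`. -/
def RelLoop : Set C(I^(Fin (n + 1)), P.carrier) :=
  {f | (∀ t ∈ Cube.boundary (Fin (n + 1)), f t ∈ P.sub) ∧ ∀ t ∈ jFace n, f t = P.pt}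

variable {P n}

/-- Homotopy through maps of triples. -/
def RelHomotopic (f g : P.RelLoop n) : Prop :=
  ContinuousMap.HomotopicWith f.1 g.1 (· ∈ P.RelLoop n)

variable (P n)

/-- Homotopy of maps of triples, as a setoid. -/
instance relSetoid : Setoid (P.RelLoop n) where
  r := RelHomotopic
  iseqv := ⟨fun f => ContinuousMap.HomotopicWith.refl f.1 f.2,
    fun h => ContinuousMap.HomotopicWith.symm h,
    fun h h' => ContinuousMap.HomotopicWith.trans h h'⟩

/-- The relative homotopy set `π_(n+1)(X, A, x)`. -/
def RelPi : Type u := Quotient (P.relSetoid n)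

variable {P n}

/-- The class of a map of triples. -/
def RelPi.mk (f : P.RelLoop n) : P.RelPi n := Quotient.mk _ f

theorem RelPi.ind {p : P.RelPi n → Prop} (h : ∀ f, p (RelPi.mk f)) (a) : p a := by
  obtain ⟨f⟩ := a
  exact h f

theorem RelPi.sound {f g : P.RelLoop n} (h : RelHomotopic f g) : RelPi.mk f = RelPi.mk g :=
  Quotient.sound h

/-- The constant map of triples. -/
def relConst : P.RelLoop n :=
  ⟨ContinuousMap.const _ P.pt, fun _ _ => P.pt_mem, fun _ _ => rfl⟩

theorem mem_boundary_cons {n : ℕ} {s : I} {t : I^(Fin (n + 1))} :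
    (Fin.cons s t : I^(Fin (n + 2))) ∈ Cube.boundary (Fin (n + 2)) ↔
      (s = 0 ∨ s = 1) ∨ t ∈ Cube.boundary (Fin (n + 1)) := by
  simp [Cube.boundary, Fin.exists_fin_succ]

theorem mem_jFace_cons {n : ℕ} {s : I} {t : I^(Fin (n + 1))} :
    (Fin.cons s t : I^(Fin (n + 2))) ∈ jFace (n + 1) ↔ (s = 0 ∨ s = 1) ∨ t ∈ jFace n := by
  change (_ ∨ _) ↔ _ ∨ (_ ∨ _)
  rw [Fin.exists_fin_succ]
  simp only [← Fin.succ_last, Fin.cons_succ, Fin.cons_zero, ne_eq, Fin.succ_inj]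
  rw [or_left_comm]
  simp

/-- The loop of `n + 1`-cubes given by an `n + 2`-cube, read along the first coordinate. -/
def toLoop (f : P.RelLoop (n + 1)) :
    Path (relConst : P.RelLoop n) (relConst : P.RelLoop n) where
  toFun s := ⟨⟨fun t => f.1 (Fin.cons s t), by fun_prop⟩,
    fun t ht => f.2.1 _ (mem_boundary_cons.2 (Or.inr ht)),
    fun t ht => f.2.2 _ (mem_jFace_cons.2 (Or.inr ht))⟩
  continuous_toFun := by
    refine Continuous.subtype_mk (ContinuousMap.continuous_of_continuous_uncurry _ ?_) _
    exact f.1.continuous.comp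
      (Continuous.finCons (A := fun _ => I) continuous_fst continuous_snd)
  source' := Subtype.ext (ContinuousMap.ext fun t =>
    f.2.2 _ (mem_jFace_cons.2 (Or.inl (Or.inl rfl))))
  target' := Subtype.ext (ContinuousMap.ext fun t =>
    f.2.2 _ (mem_jFace_cons.2 (Or.inl (Or.inr rfl))))

/-- The `n + 2`-cube given by a loop of `n + 1`-cubes. -/
def fromLoop (γ : Path (relConst : P.RelLoop n) (relConst : P.RelLoop n)) : P.RelLoop (n + 1) :=
  ⟨⟨fun t => (γ (t 0)).1 (Fin.tail t), by
      have h : Continuous fun t : I^(Fin (n + 2)) => (γ (t 0)).1 :=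
        continuous_subtype_val.comp (γ.continuous.comp (continuous_apply 0))
      have h' : Continuous fun t : I^(Fin (n + 2)) => (Fin.tail t : I^(Fin (n + 1))) :=
        continuous_pi fun i => continuous_apply _
      exact h.eval h'⟩,
    fun t ht => by
      rw [← Fin.cons_self_tail t] at ht
      rcases mem_boundary_cons.1 ht with (h | h) | h
      · change (γ (t 0)).1 (Fin.tail t) ∈ P.sub
        rw [h, γ.source]
        exact P.pt_mem
      · change (γ (t 0)).1 (Fin.tail t) ∈ P.sub
        rw [h, γ.target]
        exact P.pt_mem
      · exact (γ (t 0)).2.1 _ h,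
    fun t ht => by
      rw [← Fin.cons_self_tail t] at ht
      rcases mem_jFace_cons.1 ht with (h | h) | h
      · simp [h, γ.source]; rfl
      · simp [h, γ.target]; rfl
      · exact (γ (t 0)).2.2 _ h⟩

/-- Maps of triples on the `n + 2`-cube are loops in the space of maps of triples on the
`n + 1`-cube. -/
def loopEquiv : P.RelLoop (n + 1) ≃ Path (relConst : P.RelLoop n) (relConst : P.RelLoop n) where
  toFun := toLoop
  invFun := fromLoop
  left_inv f := by
    ext t
    exact congrArg f.1 (Fin.cons_self_tail t)
  right_inv γ := by
    ext s t
    rfl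

theorem toLoop_homotopic {f g : P.RelLoop (n + 1)} (h : RelHomotopic f g) :
    (toLoop f).Homotopic (toLoop g) := by
  obtain ⟨H⟩ := h
  have hH : ∀ s : I, (⟨fun t => H (s, t), by fun_prop⟩ : C(I^(Fin (n + 2)), P.carrier)) ∈
    P.RelLoop (n + 1) := fun s => H.prop s
  refine ⟨⟨⟨⟨fun z => toLoop ⟨_, hH z.1⟩ z.2, ?_⟩, ?_, ?_⟩, ?_⟩⟩
  · refine Continuous.subtype_mk (ContinuousMap.continuous_of_continuous_uncurry _ ?_) _
    exact H.continuous.comp ((continuous_fst.comp continuous_fst).prodMk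
      (Continuous.finCons (A := fun _ => I) (continuous_snd.comp continuous_fst) continuous_snd))
  · intro s; ext t; exact H.apply_zero _
  · intro s; ext t; exact H.apply_one _
  · rintro r s (rfl | rfl)
    · simp
    · simp

theorem toLoop_homotopic_iff {f g : P.RelLoop (n + 1)} :
    (toLoop f).Homotopic (toLoop g) ↔ RelHomotopic f g := by
  refine ⟨?_, toLoop_homotopic⟩
  rintro ⟨H⟩
  have hc : Continuous fun z : I × (I^(Fin (n + 2))) => (H (z.1, z.2 0)).1 (Fin.tail z.2) := by
    have h : Continuous fun z : I × (I^(Fin (n + 2))) => (H (z.1, z.2 0)).1 := by fun_prop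
    have h' : Continuous fun z : I × (I^(Fin (n + 2))) => (Fin.tail z.2 : I^(Fin (n + 1))) :=
      continuous_pi fun i => (continuous_apply _).comp continuous_snd
    exact h.eval h'
  refine ⟨⟨⟨⟨_, hc⟩, ?_, ?_⟩, ?_⟩⟩
  · intro t
    change (H (0, t 0)).1 (Fin.tail t) = f.1 t
    rw [H.apply_zero]
    exact congrArg f.1 (Fin.cons_self_tail t)
  · intro t
    change (H (1, t 0)).1 (Fin.tail t) = g.1 t
    rw [H.apply_one]
    exact congrArg g.1 (Fin.cons_self_tail t)
  · intro s
    exact (fromLoop (H.eval s)).2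

/-- `π_(n+2)(X, A, x)` is the fundamental group of the space of maps of triples on `I^(n+1)`. -/
def relPiEquiv : P.RelPi (n + 1) ≃
    Path.Homotopic.Quotient (relConst : P.RelLoop n) (relConst : P.RelLoop n) :=
  Quotient.congr loopEquiv (fun _ _ => toLoop_homotopic_iff.symm)

/-- The group structure on `π_(n+2)(X, A, x)`: concatenation along the first coordinate. -/
instance relPiGroup : Group (P.RelPi (n + 1)) :=
  letI : Mul (P.RelPi (n + 1)) := ⟨fun a b => relPiEquiv.symm ((relPiEquiv a).trans (relPiEquiv b))⟩
  letI : One (P.RelPi (n + 1)) := ⟨relPiEquiv.symm (.refl _)⟩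
  letI : Inv (P.RelPi (n + 1)) := ⟨fun a => relPiEquiv.symm (relPiEquiv a).symm⟩
  have hm : ∀ a b : P.RelPi (n + 1),
    a * b = relPiEquiv.symm ((relPiEquiv a).trans (relPiEquiv b)) := fun _ _ => rfl
  have ho : (1 : P.RelPi (n + 1)) = relPiEquiv.symm (.refl _) := rfl
  have hi : ∀ a : P.RelPi (n + 1), a⁻¹ = relPiEquiv.symm (relPiEquiv a).symm := fun _ => rfl
  Group.ofLeftAxioms
    (fun a b c => by simp [hm]) (fun a => by simp [hm, ho])
    (fun a => by simp [hm, ho, hi])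

theorem RelPi.one_eq : (1 : P.RelPi (n + 1)) = RelPi.mk relConst := rfl

/-- Concatenation along the first coordinate. -/
def relConcat (f g : P.RelLoop (n + 1)) : P.RelLoop (n + 1) :=
  fromLoop ((toLoop f).trans (toLoop g))

theorem RelPi.mk_mul' (f g : P.RelLoop (n + 1)) :
    RelPi.mk f * RelPi.mk g = RelPi.mk (relConcat f g) := rfl

theorem relConcat_apply (f g : P.RelLoop (n + 1)) (t) :
    (relConcat f g).1 t = concatFun f.1 g.1 t := by
  have key : ∀ s : I, (Fin.cons s (Fin.tail t) : I^(Fin (n + 2))) = Function.update t 0 s := by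
    intro s
    rw [← Fin.cons_self_tail t, Fin.update_cons_zero]
    simp
  change (((toLoop f).trans (toLoop g)) (t 0)).1 (Fin.tail t) = _
  rw [Path.trans_apply]
  unfold concatFun
  split_ifs with h
  · rw [← key, Set.projIcc_of_mem]; rfl
  · rw [← key, Set.projIcc_of_mem]; rfl

theorem RelPi.mk_mul (f g h : P.RelLoop (n + 1)) (e : ∀ t, h.1 t = concatFun f.1 g.1 t) :
    RelPi.mk f * RelPi.mk g = RelPi.mk h := by
  have : h = relConcat f g := by
    ext t
    rw [e, relConcat_apply]
  rw [this, RelPi.mk_mul']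

end RelLoops

section RelOne

theorem fin_one_eq (i : Fin (0 + 1)) : i = 0 := Subsingleton.elim (α := Fin 1) i 0

variable {P : PtPair.{u}}

/-- A map of triples on `I^1`, as a path that ends at the base point. -/
def toPath (f : P.RelLoop 0) : Path (f.1 (fun _ => 0)) P.pt where
  toFun t := f.1 (fun _ => t)
  source' := rfl
  target' := f.2.2 _ (Or.inl rfl)

/-- A path from a point of the subspace to the base point, as a map of triples on `I^1`. -/
def ofPath {a : P.carrier} (ha : a ∈ P.sub) (γ : Path a P.pt) : P.RelLoop 0 :=
  ⟨⟨fun t => γ (t 0), by fun_prop⟩, fun t ht => by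
      obtain ⟨i, hi | hi⟩ := ht
      · rw [fin_one_eq i] at hi
        simpa [hi] using ha
      · rw [fin_one_eq i] at hi
        simpa [hi] using P.pt_mem,
    fun t ht => by
      rcases ht with hi | ⟨i, hi, -⟩
      · rw [fin_one_eq (Fin.last 0)] at hi
        simp [hi]
      · exact absurd (fin_one_eq i) hi⟩

theorem start_mem (f : P.RelLoop 0) : f.1 (fun _ => 0) ∈ P.sub := f.2.1 _ ⟨0, Or.inl rfl⟩

theorem ofPath_toPath (f : P.RelLoop 0) : ofPath (start_mem f) (toPath f) = f := by
  ext t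
  exact congrArg f.1 (funext fun i => by rw [fin_one_eq i])

theorem ofPath_homotopic {a : P.carrier} (ha : a ∈ P.sub) {γ γ' : Path a P.pt}
    (h : γ.Homotopic γ') : RelHomotopic (ofPath ha γ) (ofPath ha γ') := by
  obtain ⟨H⟩ := h
  refine ⟨⟨⟨⟨fun z => H (z.1, z.2 0), by fun_prop⟩, fun t => H.apply_zero _,
    fun t => H.apply_one _⟩, fun s => ?_⟩⟩
  exact (ofPath ha (H.eval s)).2

/-- A map of triples on `I^1` followed by a loop at the base point. -/
def relAct (f : P.RelLoop 0) (ω : GenLoop (Fin 1) P.carrier P.pt) : P.RelLoop 0 :=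
  ofPath (start_mem f) ((toPath f).trans (genLoopEquivOfUnique (Fin 1) ω))

theorem relAct_homotopic {f f' : P.RelLoop 0} {ω ω' : GenLoop (Fin 1) P.carrier P.pt}
    (h : RelHomotopic f f') (h' : GenLoop.Homotopic ω ω') :
    RelHomotopic (relAct f ω) (relAct f' ω') := by
  obtain ⟨H⟩ := h
  obtain ⟨S⟩ := h'
  let F : I → P.RelLoop 0 := fun s => ⟨⟨fun t => H (s, t), by fun_prop⟩, H.prop s⟩
  let G : I → GenLoop (Fin 1) P.carrier P.pt := fun s => ⟨⟨fun t => S (s, t), by fun_prop⟩,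
    fun t ht => (S.eq_fst s ht).trans (ω.2 t ht)⟩
  have hc := Path.trans_continuous_family (fun s => toPath (F s))
    (show Continuous fun z : I × I => H (z.1, fun _ => z.2) by fun_prop)
    (fun s => genLoopEquivOfUnique (Fin 1) (G s))
    (show Continuous fun z : I × I => S (z.1, fun _ => z.2) by fun_prop)
  refine ⟨⟨⟨⟨fun z => (relAct (F z.1) (G z.1)).1 z.2, ?_⟩, ?_, ?_⟩, fun s => ?_⟩⟩
  · exact hc.comp (continuous_fst.prodMk ((continuous_apply 0).comp continuous_snd))
  · intro t
    have hF : F 0 = f := by ext t; exact H.apply_zero t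
    have hG : G 0 = ω := by ext t; exact S.apply_zero t
    change (relAct (F 0) (G 0)).1 t = _
    rw [hF, hG]
  · intro t
    have hF : F 1 = f' := by ext t; exact H.apply_one t
    have hG : G 1 = ω' := by ext t; exact S.apply_one t
    change (relAct (F 1) (G 1)).1 t = _
    rw [hF, hG]
  · exact (relAct (F s) (G s)).2

/-- The right action of `π₁(X, x)` on `π₁(X, A, x)` by concatenation. -/
def RelPi.act (a : P.RelPi 0) (g : PiGrp 0 P.carrier P.pt) : P.RelPi 0 :=
  Quotient.map₂ relAct (fun _ _ h _ _ h' => relAct_homotopic h h') a g.unop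

@[simp] theorem RelPi.act_mk (f : P.RelLoop 0) (ω : GenLoop (Fin 1) P.carrier P.pt) :
    (RelPi.mk f).act (PiGrp.mk ω) = RelPi.mk (relAct f ω) := rfl

theorem RelPi.act_one (a : P.RelPi 0) : a.act 1 = a := by
  induction a using RelPi.ind with | h f => ?_
  rw [PiGrp.one_eq, RelPi.act_mk]
  refine RelPi.sound ?_
  have h := ofPath_homotopic (start_mem f) (Path.Homotopic.trans_refl (toPath f))
  rwa [ofPath_toPath] at h

theorem RelPi.act_mul (a : P.RelPi 0) (g h : PiGrp 0 P.carrier P.pt) :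
    a.act (g * h) = (a.act g).act h := by
  induction a using RelPi.ind with | h f => ?_
  induction g using PiGrp.ind with | h ω => ?_
  induction h using PiGrp.ind with | h τ => ?_
  rw [PiGrp.mk_mul']
  simp only [RelPi.act_mk]
  have key : genLoopEquivOfUnique (Fin 1) (GenLoop.transAt 0 ω τ) =
    (genLoopEquivOfUnique (Fin 1) ω).trans (genLoopEquivOfUnique (Fin 1) τ) :=
      HomotopyGroup.genLoopEquivOfUnique_transAt (Fin 1) τ ω
  have h := ofPath_homotopic (start_mem f) (Path.Homotopic.trans_assoc (toPath f)
    (genLoopEquivOfUnique (Fin 1) ω) (genLoopEquivOfUnique (Fin 1) τ))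
  rw [← key] at h
  symm
  refine RelPi.sound ?_
  convert h using 1
  swap
  · rfl
  ext t
  have hs : (relAct f ω).1 (fun _ => 0) = f.1 (fun _ => 0) :=
    ((toPath f).trans (genLoopEquivOfUnique (Fin 1) ω)).source
  change ((toPath (relAct f ω)).trans _) (t 0) = (((toPath f).trans _).trans _) (t 0)
  rw [Path.trans_apply, Path.trans_apply]
  rfl

end RelOne

section RelMap

variable {P Q R : PtPair.{u}} {n : ℕ}

/-- Postcomposition with a map of pointed pairs. -/
def relLoopMap (φ : P ⟶ Q) (f : P.RelLoop n) : Q.RelLoop n :=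
  ⟨φ.toMap.comp f.1, fun t ht => φ.map_sub _ (f.2.1 t ht),
    fun t ht => (congrArg φ.toMap (f.2.2 t ht)).trans φ.map_pt⟩

theorem relLoopMap_homotopic (φ : P ⟶ Q) {f g : P.RelLoop n} (h : RelHomotopic f g) :
    RelHomotopic (relLoopMap φ f) (relLoopMap φ g) := by
  obtain ⟨H⟩ := h
  exact ⟨⟨⟨φ.toMap.comp H.toContinuousMap, fun t => congrArg φ.toMap (H.apply_zero t),
    fun t => congrArg φ.toMap (H.apply_one t)⟩, fun s => (relLoopMap φ ⟨_, H.prop s⟩).2⟩⟩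

/-- The map of relative homotopy sets induced by a map of pointed pairs. -/
def RelPi.map (φ : P ⟶ Q) : P.RelPi n → Q.RelPi n :=
  Quotient.map (relLoopMap φ) (fun _ _ h => relLoopMap_homotopic φ h)

@[simp] theorem RelPi.map_mk (φ : P ⟶ Q) (f : P.RelLoop n) :
    RelPi.map φ (RelPi.mk f) = RelPi.mk (relLoopMap φ f) := rfl

theorem RelPi.map_const (φ : P ⟶ Q) :
    RelPi.map φ (RelPi.mk (relConst : P.RelLoop n)) = RelPi.mk relConst := by
  rw [RelPi.map_mk]
  congr 1
  ext t
  exact φ.map_pt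

/-- The homomorphism of relative homotopy groups induced by a map of pointed pairs. -/
def RelPi.mapHom (φ : P ⟶ Q) : P.RelPi (n + 1) →* Q.RelPi (n + 1) :=
  MonoidHom.mk' (RelPi.map φ) (by
    intro a b
    induction a using RelPi.ind with | h f => ?_
    induction b using RelPi.ind with | h g => ?_
    rw [RelPi.mk_mul']
    refine (RelPi.mk_mul (relLoopMap φ f) (relLoopMap φ g) _ fun t => ?_).symm
    change φ.toMap ((relConcat f g).1 t) = _
    rw [relConcat_apply]
    exact comp_concatFun φ.toMap f.1 g.1 t)

theorem RelPi.map_act (φ : P ⟶ Q) (a : P.RelPi 0) (g : PiGrp 0 P.carrier P.pt) :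
    RelPi.map φ (a.act g) = (RelPi.map φ a).act (PiGrp.map φ.toMap φ.map_pt g) := by
  induction a using RelPi.ind with | h f => ?_
  induction g using PiGrp.ind with | h ω => ?_
  simp only [RelPi.act_mk, RelPi.map_mk, PiGrp.map_mk]
  congr 1
  ext t
  change φ.toMap (((toPath f).trans _) (t 0)) = ((toPath (relLoopMap φ f)).trans _) (t 0)
  rw [Path.trans_apply, Path.trans_apply]
  split_ifs <;> rfl

end RelMap

/-- Relative homotopy with values in actions: `π₀(X, A)` is the cokernel of `π₀(A) → π₀(X)`,
`π₁(X, A)` is a pointed set with a right action of `π₁(X)`, and `π_k(X, A)` is a group for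
`k ≥ 2`. -/
def relFun : ℕ → (PtPair.{u} ⥤ ActCat.{u})
  | 0 =>
    { obj := fun P => ActCat.cok ((piFun 0).map (incl.app P))
      map := fun φ => ActCat.cokMap _ _ ((piFun 0).map (subspace.map φ))
        ((piFun 0).map (total.map φ)) (by
          rw [← Functor.map_comp, ← Functor.map_comp, ← incl.naturality])
      map_id := by
        intro X; apply ActCat.hom_ext
        · funext a; obtain ⟨⟨a⟩⟩ := a; rfl
        · rfl
      map_comp := by
        intro X Y Z f g; apply ActCat.hom_ext
        · funext a; obtain ⟨⟨a⟩⟩ := a; rfl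
        · rfl }
  | 1 =>
    { obj := fun P =>
        { pts := P.RelPi 0
          grp := PiGrp 0 P.carrier P.pt
          zero := RelPi.mk relConst
          act := RelPi.act
          act_one := RelPi.act_one
          act_mul := RelPi.act_mul }
      map := fun φ => ⟨RelPi.map φ, PiGrp.map φ.toMap φ.map_pt, RelPi.map_const φ,
        RelPi.map_act φ⟩
      map_id := by
        intro X; apply ActCat.hom_ext
        · funext a; induction a using RelPi.ind with | h a => rfl
        · ext a; induction a using PiGrp.ind with | h a => rfl
      map_comp := by
        intro X Y Z f g; apply ActCat.hom_ext
        · funext a; induction a using RelPi.ind with | h a => rfl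
        · ext a; induction a using PiGrp.ind with | h a => rfl }
  | k + 2 =>
    { obj := fun P => ActCat.ofGroup (P.RelPi (k + 1))
      map := fun φ => ActCat.ofGroupHom (RelPi.mapHom φ)
      map_id := by
        intro X; apply ActCat.hom_ext
        · funext a; induction a using RelPi.ind with | h a => rfl
        · ext a; induction a using RelPi.ind with | h a => rfl
      map_comp := by
        intro X Y Z f g; apply ActCat.hom_ext
        · funext a; induction a using RelPi.ind with | h a => rfl
        · ext a; induction a using RelPi.ind with | h a => rfl }

section Sequence

variable {P : PtPair.{u}} {n : ℕ}

/-- A cube whose boundary is sent to the base point is a map of triples. -/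
def relOfGenLoop (f : GenLoop (Fin (n + 1)) P.carrier P.pt) : P.RelLoop n :=
  ⟨f.1, fun t ht => by rw [f.2 t ht]; exact P.pt_mem, fun t ht => f.2 t (by
    rcases ht with h | ⟨i, -, h⟩
    · exact ⟨_, Or.inr h⟩
    · exact ⟨i, h⟩)⟩

theorem relOfGenLoop_homotopic {f g : GenLoop (Fin (n + 1)) P.carrier P.pt}
    (h : GenLoop.Homotopic f g) : RelHomotopic (relOfGenLoop (P := P) f) (relOfGenLoop g) := by
  obtain ⟨H⟩ := h
  exact ⟨⟨H.toHomotopy, fun s => (relOfGenLoop (P := P)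
    ⟨H.toHomotopy.curry s, fun t ht => (H.eq_fst s ht).trans (f.2 t ht)⟩).2⟩⟩

/-- The map `π_(n+1)(X, x) → π_(n+1)(X, A, x)`. -/
def relOfPi (a : PiGrp n P.carrier P.pt) : P.RelPi n :=
  Quotient.map relOfGenLoop (fun _ _ h => relOfGenLoop_homotopic h) a.unop

@[simp] theorem relOfPi_mk (f : GenLoop (Fin (n + 1)) P.carrier P.pt) :
    relOfPi (PiGrp.mk f) = RelPi.mk (relOfGenLoop (P := P) f) := rfl

theorem relOfPi_act (a b : PiGrp 0 P.carrier P.pt) :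
    (relOfPi (a * b) : P.RelPi 0) = (relOfPi a : P.RelPi 0).act b := by
  induction a using PiGrp.ind with | h f => ?_
  induction b using PiGrp.ind with | h g => ?_
  rw [PiGrp.mk_mul']
  simp only [relOfPi_mk, RelPi.act_mk]
  congr 1
  ext t
  have key : genLoopEquivOfUnique (Fin 1) (GenLoop.transAt 0 f g) =
    (genLoopEquivOfUnique (Fin 1) f).trans (genLoopEquivOfUnique (Fin 1) g) :=
      HomotopyGroup.genLoopEquivOfUnique_transAt (Fin 1) g f
  have ht : t = fun _ => t 0 := funext fun i => by rw [fin_one_eq i]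
  have := congrArg (fun γ : Path P.pt P.pt => γ (t 0)) key
  change (GenLoop.transAt 0 f g) (fun _ => t 0) = _ at this
  change (GenLoop.transAt 0 f g) t = ((toPath (relOfGenLoop (P := P) f)).trans _) (t 0)
  rw [ht, this, Path.trans_apply, Path.trans_apply]
  rfl

/-- The homomorphism `π_(n+2)(X, x) → π_(n+2)(X, A, x)`. -/
def relOfPiHom : PiGrp (n + 1) P.carrier P.pt →* P.RelPi (n + 1) :=
  MonoidHom.mk' relOfPi (by
    intro a b
    induction a using PiGrp.ind with | h f => ?_
    induction b using PiGrp.ind with | h g => ?_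
    rw [PiGrp.mk_mul']
    exact (RelPi.mk_mul (relOfGenLoop (P := P) f) (relOfGenLoop (P := P) g) _
      fun t => rfl).symm)

/-- Restriction of a map of triples to the distinguished face. -/
def faceLoop (f : P.RelLoop (n + 1)) :
    GenLoop (Fin (n + 1)) P.sub (⟨P.pt, P.pt_mem⟩ : P.sub) :=
  ⟨⟨fun t => ⟨f.1 (Fin.snoc t 0), f.2.1 _ ⟨Fin.last _, Or.inl (by simp)⟩⟩,
      Continuous.subtype_mk (f.1.continuous.comp
        (Continuous.finSnoc (A := fun _ => I) continuous_id continuous_const)) _⟩,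
    fun t ht => Subtype.ext (f.2.2 _ (by
      obtain ⟨i, hi⟩ := ht
      exact Or.inr ⟨i.castSucc, (Fin.castSucc_lt_last i).ne, by simpa using hi⟩))⟩

theorem faceLoop_homotopic {f g : P.RelLoop (n + 1)} (h : RelHomotopic f g) :
    GenLoop.Homotopic (faceLoop f) (faceLoop g) := by
  obtain ⟨H⟩ := h
  let F : I → P.RelLoop (n + 1) := fun s => ⟨⟨fun t => H (s, t), by fun_prop⟩, H.prop s⟩
  refine ⟨⟨⟨⟨fun z => faceLoop (F z.1) z.2, ?_⟩, ?_, ?_⟩, ?_⟩⟩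
  · refine Continuous.subtype_mk (H.continuous.comp (continuous_fst.prodMk ?_)) _
    exact Continuous.finSnoc (A := fun _ => I) continuous_snd continuous_const
  · intro t; exact Subtype.ext (H.apply_zero _)
  · intro t; exact Subtype.ext (H.apply_one _)
  · intro s t ht
    exact ((faceLoop (F s)).2 t ht).trans ((faceLoop f).2 t ht).symm

/-- The boundary homomorphism `π_(n+2)(X, A, x) → π_(n+1)(A, x)`. -/
def boundaryHom : P.RelPi (n + 1) →* PiGrp n P.sub (⟨P.pt, P.pt_mem⟩ : P.sub) :=
  MonoidHom.mk' (fun a => MulOpposite.op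
    (Quotient.map faceLoop (fun _ _ h => faceLoop_homotopic h) a)) (by
    intro a b
    induction a using RelPi.ind with | h f => ?_
    induction b using RelPi.ind with | h g => ?_
    rw [RelPi.mk_mul']
    refine (PiGrp.mk_mul (faceLoop f) (faceLoop g) (faceLoop (relConcat f g))
      fun t => Subtype.ext ?_).symm
    change (relConcat f g).1 (Fin.snoc t 0) = _
    rw [relConcat_apply]
    have key : ∀ s : I, (Fin.snoc (Function.update t 0 s) 0 : I^(Fin (n + 2))) =
        Function.update (Fin.snoc t 0 : I^(Fin (n + 2))) 0 s := fun s => by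
      rw [Fin.snoc_update]; rfl
    have h0 : (Fin.snoc t 0 : I^(Fin (n + 2))) 0 = t 0 := Fin.snoc_castSucc (i := 0) ..
    unfold concatFun
    rw [h0]
    simp only [← key]
    split_ifs <;> rfl)

/-- The map `π₁(X, A, x) → π₀(A)`, sending a path to its starting point. -/
def boundaryZero : P.RelPi 0 → ZerothHomotopy P.sub :=
  Quotient.lift (fun f => ZerothHomotopy.mk ⟨f.1 (fun _ => 0), start_mem f⟩) (by
    rintro f g ⟨H⟩
    refine ZerothHomotopy.sound ?_
    exact
      { toFun := fun s => ⟨H (s, fun _ => 0), (H.prop s).1 _ ⟨0, Or.inl rfl⟩⟩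
        source' := Subtype.ext (H.apply_zero _)
        target' := Subtype.ext (H.apply_one _) })

/-- A map of triples for the pair `(X, {x})` is a cube whose boundary is sent to the base point. -/
def genLoopOfRel {B : PtTop.{u}} (f : (ofPtTop.obj B).RelLoop n) :
    GenLoop (Fin (n + 1)) B.carrier B.pt :=
  ⟨f.1, fun t ht => f.2.1 t ht⟩

theorem genLoopOfRel_homotopic {B : PtTop.{u}} {f g : (ofPtTop.obj B).RelLoop n}
    (h : RelHomotopic f g) : GenLoop.Homotopic (genLoopOfRel f) (genLoopOfRel g) := by
  obtain ⟨H⟩ := h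
  exact ⟨⟨H.toHomotopy, fun s t ht => ((H.prop s).1 t ht).trans (f.2.1 t ht).symm⟩⟩

/-- The map `π_(n+1)(B, {b}, b) → π_(n+1)(B, b)`. -/
def piOfRel {B : PtTop.{u}} (a : (ofPtTop.obj B).RelPi n) : PiGrp n B.carrier B.pt :=
  MulOpposite.op (Quotient.map genLoopOfRel (fun _ _ h => genLoopOfRel_homotopic h) a)

@[simp] theorem piOfRel_mk {B : PtTop.{u}} (f : (ofPtTop.obj B).RelLoop n) :
    piOfRel (RelPi.mk f) = PiGrp.mk (genLoopOfRel f) := rfl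

theorem piOfRel_relOfPi {B : PtTop.{u}} (a : PiGrp n B.carrier B.pt) :
    piOfRel (relOfPi a : (ofPtTop.obj B).RelPi n) = a := by
  induction a using PiGrp.ind with | h f => rfl

theorem relOfPi_piOfRel {B : PtTop.{u}} (a : (ofPtTop.obj B).RelPi n) :
    (relOfPi (piOfRel a) : (ofPtTop.obj B).RelPi n) = a := by
  induction a using RelPi.ind with | h f => rfl

end Sequence

/-- The morphisms `π_k(A) → π_k(X)` induced by the inclusion. -/
def inclMap (k : ℕ) : subspace.{u} ⋙ piFun k ⟶ total ⋙ piFun k :=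
  Functor.whiskerRight incl (piFun k)

/-- The morphisms `π_k(X) → π_k(X, A)`: for `k = 0` the projection onto the cokernel, for `k = 1`
the map `ω ↦ 0 · ω` together with the identity of `π₁(X)`. -/
def toRel : ∀ k : ℕ, total.{u} ⋙ piFun k ⟶ relFun k
  | 0 =>
    { app := fun P => ActCat.cokProj ((piFun 0).map (incl.app P))
      naturality := fun _ _ _ => rfl }
  | 1 =>
    { app := fun P => ⟨relOfPi, MonoidHom.id _, rfl, relOfPi_act⟩
      naturality := by
        intro P Q φ
        apply ActCat.hom_ext
        · funext a; induction a using PiGrp.ind with | h a => rfl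
        · ext a; induction a using PiGrp.ind with | h a => rfl }
  | k + 2 =>
    { app := fun P => ActCat.ofGroupHom relOfPiHom
      naturality := by
        intro P Q φ
        apply ActCat.hom_ext
        · funext a; induction a using PiGrp.ind with | h a => rfl
        · ext a; induction a using PiGrp.ind with | h a => rfl }

/-- The morphisms `π_(k+1)(X, A) → π_k(A)` given by restriction to the distinguished face. -/
def boundaryMap : ∀ k : ℕ, relFun.{u} (k + 1) ⟶ subspace ⋙ piFun k
  | 0 =>
    { app := fun P => ⟨boundaryZero, 1, rfl, by
        intro a g
        induction a using RelPi.ind with | h f => ?_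
        induction g using PiGrp.ind with | h ω => ?_
        refine congrArg ZerothHomotopy.mk (Subtype.ext ?_)
        exact ((toPath f).trans (genLoopEquivOfUnique (Fin 1) ω)).source⟩
      naturality := by
        intro P Q φ
        apply ActCat.hom_ext
        · funext a; induction a using RelPi.ind with | h a => rfl
        · rfl }
  | k + 1 =>
    { app := fun P => ActCat.ofGroupHom boundaryHom
      naturality := by
        intro P Q φ
        apply ActCat.hom_ext
        · funext a; induction a using RelPi.ind with | h a => rfl
        · ext a; induction a using RelPi.ind with | h a => rfl }

/-- The identification `π_k(B, {b}) → π_k(B)`. -/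
def relPoint : ∀ k : ℕ, ofPtTop.{u} ⋙ relFun k ⟶ piFun k
  | 0 =>
    { app := fun B => ActCat.cokDesc _ (𝟙 ((piFun 0).obj B)) (by
        rintro ⟨⟨a, rfl⟩⟩
        rfl)
      naturality := by
        intro B C φ
        apply ActCat.hom_ext
        · funext a; obtain ⟨⟨a⟩⟩ := a; rfl
        · rfl }
  | 1 =>
    { app := fun B => ⟨piOfRel, MonoidHom.id _, rfl, fun a g => by
        obtain ⟨b, rfl⟩ : ∃ b, relOfPi b = a := ⟨_, relOfPi_piOfRel a⟩
        change PiGrp 0 B.carrier B.pt at b g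
        refine (congrArg piOfRel (relOfPi_act (P := ofPtTop.obj B) b g).symm).trans ?_
        refine (piOfRel_relOfPi _).trans ?_
        exact congrArg (· * g) (piOfRel_relOfPi b).symm⟩
      naturality := by
        intro B C φ
        apply ActCat.hom_ext
        · funext a; induction a using RelPi.ind with | h a => rfl
        · rfl }
  | k + 2 =>
    { app := fun B => ActCat.ofGroupHom (MonoidHom.mk' piOfRel fun a b => by
        obtain ⟨a, rfl⟩ : ∃ b, relOfPi b = a := ⟨_, relOfPi_piOfRel a⟩
        obtain ⟨b, rfl⟩ : ∃ c, relOfPi c = b := ⟨_, relOfPi_piOfRel b⟩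
        have h := (relOfPiHom (P := ofPtTop.obj B)).map_mul a b
        change relOfPi (a * b) = relOfPi a * relOfPi b at h
        refine (congrArg piOfRel h.symm).trans ((piOfRel_relOfPi (B := B) (a * b)).trans ?_)
        exact congrArg₂ (· * ·) (piOfRel_relOfPi (B := B) a).symm
          (piOfRel_relOfPi (B := B) b).symm)
      naturality := by
        intro B C φ
        apply ActCat.hom_ext
        · funext a; induction a using RelPi.ind with | h a => rfl
        · ext a; induction a using RelPi.ind with | h a => rfl }

end PtPair

/-! ### Directed spaces and traces -/

/-- Directed spaces: a topological space with a set of paths that contains the constant paths and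
is closed under reparametrization by continuous non-decreasing maps and under concatenation. -/
structure Dispace : Type (u + 1) where
  carrier : Type u
  [top : TopologicalSpace carrier]
  dipaths : Set C(I, carrier)
  const_mem : ∀ x, ContinuousMap.const I x ∈ dipaths
  reparam_mem : ∀ γ ∈ dipaths, ∀ φ : C(I, I), Monotone φ → γ.comp φ ∈ dipaths
  trans_mem : ∀ {x y z : carrier} (γ : Path x y) (δ : Path y z),
    γ.toContinuousMap ∈ dipaths → δ.toContinuousMap ∈ dipaths →
      (γ.trans δ).toContinuousMap ∈ dipaths

attribute [instance] Dispace.top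

namespace Dispace

/-- Morphisms of dispaces: continuous maps that preserve dipaths. -/
structure Hom (E B : Dispace.{u}) : Type u where
  toMap : C(E.carrier, B.carrier)
  map_mem : ∀ γ ∈ E.dipaths, toMap.comp γ ∈ B.dipaths

/-- The space of dipaths from `x` to `y`, with the compact-open topology. -/
def Dipath (E : Dispace.{u}) (x y : E.carrier) : Type u :=
  {γ : Path x y // γ.toContinuousMap ∈ E.dipaths}

instance (E : Dispace.{u}) (x y : E.carrier) : TopologicalSpace (E.Dipath x y) :=
  inferInstanceAs (TopologicalSpace {γ : Path x y // γ.toContinuousMap ∈ E.dipaths})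

/-- `δ` is a monotonic reparametrization of `γ`. -/
def IsReparam {E : Dispace.{u}} {x y : E.carrier} (γ δ : E.Dipath x y) : Prop :=
  ∃ φ : C(I, I), Monotone φ ∧ φ 0 = 0 ∧ φ 1 = 1 ∧ ∀ t, δ.1 t = γ.1 (φ t)

/-- The trace space: the quotient of the space of dipaths by (the equivalence relation generated
by) monotonic reparametrization, with the quotient topology. -/
def Trace (E : Dispace.{u}) (x y : E.carrier) : Type u := Quot (IsReparam (E := E) (x := x) (y := y))

instance (E : Dispace.{u}) (x y : E.carrier) : TopologicalSpace (E.Trace x y) :=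
  inferInstanceAs (TopologicalSpace (Quot _))

section Traces

variable {E : Dispace.{u}} {x y z w : E.carrier}

/-- The trace of a dipath. -/
def Trace.mk (γ : E.Dipath x y) : E.Trace x y := Quot.mk _ γ

theorem Trace.ind {p : E.Trace x y → Prop} (h : ∀ γ, p (Trace.mk γ)) (a) : p a := by
  obtain ⟨γ⟩ := a
  exact h γ

theorem Trace.continuous_mk : Continuous (Trace.mk : E.Dipath x y → E.Trace x y) :=
  continuous_quot_mk

/-- The constant dipath. -/
def Dipath.refl (x : E.carrier) : E.Dipath x x := ⟨Path.refl x, E.const_mem x⟩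

/-- Concatenation of dipaths. -/
def Dipath.trans (γ : E.Dipath x y) (δ : E.Dipath y z) : E.Dipath x z :=
  ⟨γ.1.trans δ.1, E.trans_mem _ _ γ.2 δ.2⟩

/-- A reparametrization that acts separately on the two halves of the interval. -/
theorem exists_halves (φ ψ : C(I, I)) (hφ : Monotone φ) (hψ : Monotone ψ) (φ0 : φ 0 = 0)
    (φ1 : φ 1 = 1) (ψ0 : ψ 0 = 0) (ψ1 : ψ 1 = 1) :
    ∃ χ : C(I, I), Monotone χ ∧ χ 0 = 0 ∧ χ 1 = 1 ∧
      ∀ {X : Type u} [TopologicalSpace X] {x y z : X} (γ γ' : Path x y) (δ δ' : Path y z),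
        (∀ t, γ' t = γ (φ t)) → (∀ t, δ' t = δ (ψ t)) →
          ∀ t, (γ'.trans δ') t = (γ.trans δ) (χ t) := by
  have hm : (1 / 2 : ℝ) ∈ I := by constructor <;> norm_num
  let p₁ : Path (0 : I) ⟨1 / 2, hm⟩ :=
    { toFun := fun t => ⟨(φ t : ℝ) / 2, by
        have := (φ t).2.1; have := (φ t).2.2; constructor <;> linarith⟩
      continuous_toFun := by fun_prop
      source' := by simp [φ0]
      target' := by simp [φ1] }
  let p₂ : Path (⟨1 / 2, hm⟩ : I) 1 :=
    { toFun := fun t => ⟨(1 + (ψ t : ℝ)) / 2, by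
        have := (ψ t).2.1; have := (ψ t).2.2; constructor <;> linarith⟩
      continuous_toFun := by fun_prop
      source' := by simp [ψ0]
      target' := by simp [ψ1] }
  have hp₁ : ∀ t, ((p₁ t : I) : ℝ) = (φ t : ℝ) / 2 := fun _ => rfl
  have hp₂ : ∀ t, ((p₂ t : I) : ℝ) = (1 + (ψ t : ℝ)) / 2 := fun _ => rfl
  refine ⟨(p₁.trans p₂).toContinuousMap, ?_, (p₁.trans p₂).source, (p₁.trans p₂).target, ?_⟩
  · intro s t hst
    change (p₁.trans p₂) s ≤ (p₁.trans p₂) t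
    have hst' : (s : ℝ) ≤ t := hst
    rw [Path.trans_apply, Path.trans_apply, ← Subtype.coe_le_coe]
    split_ifs with h h' h'
    · rw [hp₁, hp₁]
      have := hφ (show (⟨2 * s, (unitInterval.mul_pos_mem_iff zero_lt_two).2 ⟨s.2.1, h⟩⟩ : I) ≤
        ⟨2 * t, (unitInterval.mul_pos_mem_iff zero_lt_two).2 ⟨t.2.1, h'⟩⟩ from
          Subtype.coe_le_coe.1 (by simpa using hst'))
      rw [← Subtype.coe_le_coe] at this
      linarith
    · rw [hp₁, hp₂]
      have h1 := (φ ⟨2 * s, (unitInterval.mul_pos_mem_iff zero_lt_two).2 ⟨s.2.1, h⟩⟩).2.2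
      have h2 := (ψ ⟨2 * t - 1, unitInterval.two_mul_sub_one_mem_iff.2
        ⟨(not_le.1 h').le, t.2.2⟩⟩).2.1
      linarith
    · exact absurd (hst'.trans h') h
    · rw [hp₂, hp₂]
      have := hψ (show (⟨2 * s - 1, unitInterval.two_mul_sub_one_mem_iff.2
        ⟨(not_le.1 h).le, s.2.2⟩⟩ : I) ≤ ⟨2 * t - 1, unitInterval.two_mul_sub_one_mem_iff.2
          ⟨(not_le.1 h').le, t.2.2⟩⟩ from Subtype.coe_le_coe.1 (by simpa using hst'))
      rw [← Subtype.coe_le_coe] at this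
      linarith
  · intro X _ x y z γ γ' δ δ' hγ hδ t
    change _ = (γ.trans δ) ((p₁.trans p₂) t)
    have e₁ : ∀ s, (γ.trans δ) (p₁ s) = γ (φ s) := fun s => by
      rw [Path.trans_apply, dif_pos (by rw [hp₁]; have := (φ s).2.2; linarith)]
      congr 1
      apply Subtype.ext
      change 2 * ((φ s : ℝ) / 2) = φ s
      ring
    have e₂ : ∀ s, (γ.trans δ) (p₂ s) = δ (ψ s) := fun s => by
      have h0 := (ψ s).2.1
      rw [Path.trans_apply]
      split_ifs with h
      · rw [hp₂] at h
        have : ψ s = 0 := Subtype.ext (show (ψ s : ℝ) = 0 by linarith)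
        rw [this, δ.source]
        convert γ.target
        change 2 * ((1 + (ψ s : ℝ)) / 2) = 1
        rw [this]
        norm_num
      · congr 1
        apply Subtype.ext
        change 2 * ((1 + (ψ s : ℝ)) / 2) - 1 = ψ s
        ring
    rw [Path.trans_apply γ' δ', Path.trans_apply p₁ p₂]
    split_ifs with h
    · rw [e₁, hγ]
    · rw [e₂, hδ]

/-- Concatenation of traces. -/
def Trace.trans (a : E.Trace x y) (b : E.Trace y z) : E.Trace x z :=
  Quot.map₂ Dipath.trans
    (by
      rintro γ δ δ' ⟨ψ, hψ, ψ0, ψ1, h⟩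
      obtain ⟨χ, hχ, χ0, χ1, H⟩ := exists_halves (ContinuousMap.id I) ψ monotone_id hψ rfl rfl ψ0 ψ1
      exact ⟨χ, hχ, χ0, χ1, H γ.1 γ.1 δ.1 δ'.1 (fun _ => rfl) h⟩)
    (by
      rintro γ γ' δ ⟨ψ, hψ, ψ0, ψ1, h⟩
      obtain ⟨χ, hχ, χ0, χ1, H⟩ := exists_halves ψ (ContinuousMap.id I) hψ monotone_id ψ0 ψ1 rfl rfl
      exact ⟨χ, hχ, χ0, χ1, H γ.1 γ'.1 δ.1 δ.1 h (fun _ => rfl)⟩) a b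

@[simp] theorem Trace.trans_mk (γ : E.Dipath x y) (δ : E.Dipath y z) :
    (Trace.mk γ).trans (Trace.mk δ) = Trace.mk (γ.trans δ) := rfl

theorem Trace.trans_refl (a : E.Trace x y) : a.trans (Trace.mk (Dipath.refl y)) = a := by
  induction a using Trace.ind with | h γ => ?_
  symm
  refine Quot.sound ⟨⟨fun t => ⟨_, Path.Homotopy.transReflReparamAux_mem_I t⟩, by fun_prop⟩, ?_,
    Subtype.ext Path.Homotopy.transReflReparamAux_zero,
    Subtype.ext Path.Homotopy.transReflReparamAux_one, fun t => ?_⟩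
  · intro s t hst
    have hst' : (s : ℝ) ≤ t := hst
    rw [← Subtype.coe_le_coe]
    simp only [ContinuousMap.coe_mk, Path.Homotopy.transReflReparamAux]
    split_ifs <;> linarith [s.2.1, s.2.2]
  · exact congrArg (fun p : Path x y => p t) (Path.Homotopy.trans_refl_reparam γ.1)

theorem Trace.refl_trans (a : E.Trace x y) : (Trace.mk (Dipath.refl x)).trans a = a := by
  induction a using Trace.ind with | h γ => ?_
  symm
  refine Quot.sound ⟨⟨fun t => Set.projIcc 0 1 zero_le_one (2 * (t : ℝ) - 1), by fun_prop⟩, ?_,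
    ?_, ?_, fun t => ?_⟩
  · intro s t hst
    have hst' : (s : ℝ) ≤ t := hst
    exact Set.monotone_projIcc zero_le_one (show 2 * (s : ℝ) - 1 ≤ 2 * (t : ℝ) - 1 by linarith)
  · exact Set.projIcc_of_le_left zero_le_one (by simp)
  · exact Set.projIcc_of_right_le zero_le_one (by norm_num)
  · change ((Path.refl x).trans γ.1) t = γ.1 _
    rw [Path.trans_apply]
    split_ifs with h
    · simp only [ContinuousMap.coe_mk]
      rw [Set.projIcc_of_le_left _ (by linarith)]
      exact γ.1.source.symm
    · simp only [ContinuousMap.coe_mk]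
      rw [Set.projIcc_of_mem]

theorem Trace.trans_assoc (a : E.Trace x y) (b : E.Trace y z) (c : E.Trace z w) :
    (a.trans b).trans c = a.trans (b.trans c) := by
  induction a using Trace.ind with | h γ => ?_
  induction b using Trace.ind with | h δ => ?_
  induction c using Trace.ind with | h ε => ?_
  symm
  refine Quot.sound ⟨⟨fun t => ⟨_, Path.Homotopy.transAssocReparamAux_mem_I t⟩, by fun_prop⟩, ?_,
    Subtype.ext Path.Homotopy.transAssocReparamAux_zero,
    Subtype.ext Path.Homotopy.transAssocReparamAux_one, fun t => ?_⟩
  · intro s t hst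
    have hst' : (s : ℝ) ≤ t := hst
    rw [← Subtype.coe_le_coe]
    simp only [ContinuousMap.coe_mk, Path.Homotopy.transAssocReparamAux]
    split_ifs <;> linarith [s.2.1, s.2.2]
  · exact congrArg (fun p : Path x w => p t)
      (Path.Homotopy.trans_assoc_reparam γ.1 δ.1 ε.1)

/-- The continuous map `a ⋆ _ ⋆ b` between trace spaces. -/
def extendMap (a : E.Trace x y) (b : E.Trace z w) : C(E.Trace y z, E.Trace x w) where
  toFun f := a.trans (f.trans b)
  continuous_toFun := by
    induction a using Trace.ind with | h γ => ?_
    induction b using Trace.ind with | h δ => ?_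
    refine isQuotientMap_quot_mk.continuous_iff.2 (Trace.continuous_mk.comp ?_)
    refine Continuous.subtype_mk ?_ _
    exact continuous_const.path_trans (continuous_subtype_val.path_trans continuous_const)

end Traces

end Dispace

/-- The trace category of a dispace: its objects are the points and its morphisms are the
traces. -/
structure TraceCat (E : Dispace.{u}) : Type u where
  pt : E.carrier

instance (E : Dispace.{u}) : Category (TraceCat E) where
  Hom x y := E.Trace x.pt y.pt
  id x := Dispace.Trace.mk (Dispace.Dipath.refl x.pt)
  comp f g := Dispace.Trace.trans f g
  id_comp := Dispace.Trace.refl_trans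
  comp_id := Dispace.Trace.trans_refl
  assoc := Dispace.Trace.trans_assoc

namespace Dispace.Hom

variable {E B : Dispace.{u}} (p : E.Hom B)

/-- The image of a dipath. -/
def mapDipath {x y : E.carrier} (γ : E.Dipath x y) : B.Dipath (p.toMap x) (p.toMap y) :=
  ⟨γ.1.map p.toMap.continuous, p.map_mem _ γ.2⟩

/-- The continuous map of trace spaces induced by a morphism of dispaces. -/
def traceMap (x y : E.carrier) : C(E.Trace x y, B.Trace (p.toMap x) (p.toMap y)) where
  toFun := Quot.map p.mapDipath (by
    rintro γ δ ⟨φ, hφ, φ0, φ1, h⟩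
    exact ⟨φ, hφ, φ0, φ1, fun t => congrArg p.toMap (h t)⟩)
  continuous_toFun := by
    refine isQuotientMap_quot_mk.continuous_iff.2 (Trace.continuous_mk.comp ?_)
    refine Continuous.subtype_mk ?_ _
    rw [← Path.continuous_uncurry_iff]
    have h : Continuous fun z : E.Dipath x y × I => z.1.1 z.2 :=
      (continuous_subtype_val.comp continuous_fst).eval continuous_snd
    exact p.toMap.continuous.comp h

theorem traceMap_trans {x y z : E.carrier} (a : E.Trace x y) (b : E.Trace y z) :
    p.traceMap x z (a.trans b) = (p.traceMap x y a).trans (p.traceMap y z b) := by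
  induction a using Trace.ind with | h γ => ?_
  induction b using Trace.ind with | h δ => ?_
  exact congrArg Trace.mk (Subtype.ext (Path.map_trans γ.1 δ.1 p.toMap.continuous))

/-- The functor between trace categories induced by a morphism of dispaces. -/
def traceFunctor : TraceCat E ⥤ TraceCat B where
  obj x := ⟨p.toMap x.pt⟩
  map {x y} f := p.traceMap x.pt y.pt f
  map_id _ := rfl
  map_comp f g := p.traceMap_trans f g

end Dispace.Hom

/-! ### Natural systems -/

/-- The category of factorizations of a category: its objects are the morphisms of `C`, and a
morphism from `f` to `f'` is a pair `(u, v)` with `u f v = f'`. -/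
structure FactCat (C : Type u) [Category.{u} C] : Type u where
  src : C
  tgt : C
  hom : src ⟶ tgt

namespace FactCat

variable {C D : Type u} [Category.{u} C] [Category.{u} D]

@[ext]
structure Hom (f f' : FactCat C) : Type u where
  left : f'.src ⟶ f.src
  right : f.tgt ⟶ f'.tgt
  w : left ≫ f.hom ≫ right = f'.hom

instance : Category.{u} (FactCat C) where
  Hom := Hom
  id f := ⟨𝟙 _, 𝟙 _, by simp⟩
  comp a b := ⟨b.left ≫ a.left, a.right ≫ b.right, by
    rw [← b.w, ← a.w]
    simp⟩

/-- The functor between categories of factorizations induced by a functor. -/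
def map (F : C ⥤ D) : FactCat C ⥤ FactCat D where
  obj f := ⟨F.obj f.src, F.obj f.tgt, F.map f.hom⟩
  map a := ⟨F.map a.left, F.map a.right, by rw [← F.map_comp, ← F.map_comp, a.w]⟩
  map_id f := by apply Hom.ext <;> exact F.map_id _
  map_comp a b := by apply Hom.ext <;> exact F.map_comp _ _

end FactCat

/-- Natural systems of actions on a category. -/
abbrev NatSys (C : Type u) [Category.{u} C] : Type (u + 1) := FactCat C ⥤ ActCat.{u}

/-- A sequence of natural systems of actions is exact when it is so at every object. -/
def NatSys.Exact {C : Type u} [Category.{u} C] {D₁ D₂ D₃ : NatSys C} (α : D₁ ⟶ D₂) (β : D₂ ⟶ D₃) :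
    Prop :=
  ∀ e : FactCat C, ActCat.Exact (α.app e) (β.app e)

/-- The null natural system. -/
def NatSys.null (C : Type u) [Category.{u} C] : NatSys C := (Functor.const _).obj ActCat.null

/-- The unique morphism to the null natural system. -/
def NatSys.toNull {C : Type u} [Category.{u} C] (D : NatSys C) : D ⟶ NatSys.null C where
  app e := ActCat.toNull _

/-! ### The natural homotopy of a dispace and of the fibre system of a morphism -/

/-- The pointed trace diagram of a dispace. -/
def traceDiagram (E : Dispace.{u}) : FactCat (TraceCat E) ⥤ PtTop.{u} where
  obj e := ⟨E.Trace e.src.pt e.tgt.pt, e.hom⟩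
  map a := ⟨Dispace.extendMap a.left a.right, a.w⟩
  map_id e := by
    apply PtTop.Hom.ext
    ext f
    change E.Trace e.src.pt e.tgt.pt at f
    exact (Category.id_comp (X := e.src) (Y := e.tgt) _).trans
      (Category.comp_id (X := e.src) (Y := e.tgt) f)
  map_comp {e₁ e₂ e₃} a b := by
    apply PtTop.Hom.ext
    ext f
    change E.Trace e₁.src.pt e₁.tgt.pt at f
    change (b.left ≫ a.left) ≫ ((show e₁.src ⟶ e₁.tgt from f) ≫ a.right ≫ b.right) =
      b.left ≫ (a.left ≫ (show e₁.src ⟶ e₁.tgt from f) ≫ a.right) ≫ b.right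
    simp only [Category.assoc]

section Fibration

variable {E B : Dispace.{u}} (p : E.Hom B)

/-- The fibre of `p_e` over `p(e)`, a subspace of the trace space that contains `e`. -/
def fibre (e : FactCat (TraceCat E)) : Set (E.Trace e.src.pt e.tgt.pt) :=
  {f | p.traceMap e.src.pt e.tgt.pt f = p.traceMap e.src.pt e.tgt.pt e.hom}

/-- The natural system of pointed pairs `e ↦ (T(E)_e, T(F)_e, e)`, where `F` is the system of
fibres of `p`. -/
def fibrePair : FactCat (TraceCat E) ⥤ PtPair.{u} where
  obj e := ⟨E.Trace e.src.pt e.tgt.pt, fibre p e, e.hom, rfl⟩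
  map {e e'} a := ⟨Dispace.extendMap a.left a.right, fun f hf => by
      have h : ∀ g : E.Trace e.src.pt e.tgt.pt,
          p.traceMap e'.src.pt e'.tgt.pt (Dispace.extendMap a.left a.right g) =
            (p.traceMap _ _ a.left).trans ((p.traceMap _ _ g).trans (p.traceMap _ _ a.right)) :=
        fun g => (p.traceMap_trans _ _).trans
          (congrArg (Dispace.Trace.trans _) (p.traceMap_trans _ _))
      have hw : Dispace.extendMap a.left a.right e.hom = e'.hom := a.w
      have hf' : p.traceMap _ _ f = p.traceMap _ _ e.hom := hf
      refine (h f).trans (Eq.trans ?_ ((h e.hom).symm.trans (congrArg (p.traceMap _ _) hw)))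
      rw [hf'], a.w⟩
  map_id e := PtPair.Hom.ext (congrArg PtTop.Hom.toMap ((traceDiagram E).map_id e))
  map_comp a b := PtPair.Hom.ext (congrArg PtTop.Hom.toMap ((traceDiagram E).map_comp a b))

/-- The morphism of pointed pairs `(T(E)_e, T(F)_e, e) → (T(B)_{p(e)}, {p(e)}, p(e))`. -/
def fibrePairMap :
    fibrePair p ⟶ FactCat.map p.traceFunctor ⋙ traceDiagram B ⋙ PtPair.ofPtTop where
  app e := ⟨p.traceMap e.src.pt e.tgt.pt, fun _ hf => hf, rfl⟩
  naturality e e' a := by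
    apply PtPair.Hom.ext
    ext f
    exact (p.traceMap_trans _ _).trans (congrArg (Dispace.Trace.trans _) (p.traceMap_trans _ _))

/-- The natural homotopy of a dispace: `natHtpy E k` is the system `P_(k+1)(E)`, with value
`π_k` of the trace space. -/
def natHtpy (E : Dispace.{u}) (k : ℕ) : NatSys (TraceCat E) := traceDiagram E ⋙ piFun k

/-- The natural homotopy `P_(k+1)(F)` of the system of fibres. -/
def fibHtpy (k : ℕ) : NatSys (TraceCat E) := fibrePair p ⋙ PtPair.subspace ⋙ piFun k

/-- The relative natural homotopy: `relHtpy p k` is the system `P_(k+1)(E, F)`; for `k = 1` the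
value is the pointed set `π₁(T(E)_e, T(F)_e)` with the action of `π₁(T(E)_e)`. -/
def relHtpy (k : ℕ) : NatSys (TraceCat E) := fibrePair p ⋙ PtPair.relFun k

/-- The pullback `p^* P_(k+1)(B)`. -/
def pullHtpy (k : ℕ) : NatSys (TraceCat E) := FactCat.map p.traceFunctor ⋙ natHtpy B k

/-- The morphism `P_(k+1)(F) → P_(k+1)(E)` induced by inclusion. -/
def fibToTotal (k : ℕ) : fibHtpy p k ⟶ natHtpy E k :=
  Functor.whiskerLeft (fibrePair p) (PtPair.inclMap k)

/-- The morphism `P_(k+1)(E) → P_(k+1)(E, F)`. -/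
def totalToRel (k : ℕ) : natHtpy E k ⟶ relHtpy p k :=
  Functor.whiskerLeft (fibrePair p) (PtPair.toRel k)

/-- The morphism `P_(k+2)(E, F) → P_(k+1)(F)` given by restriction to the distinguished face. -/
def relToFib (k : ℕ) : relHtpy p (k + 1) ⟶ fibHtpy p k :=
  Functor.whiskerLeft (fibrePair p) (PtPair.boundaryMap k)

/-- The morphism `P_(k+1)(E, F) → p^* P_(k+1)(B)` induced by `p`. -/
def relToBase (k : ℕ) : relHtpy p k ⟶ pullHtpy p k :=
  Functor.whiskerRight (fibrePairMap p) (PtPair.relFun k) ≫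
    Functor.whiskerLeft (FactCat.map p.traceFunctor ⋙ traceDiagram B) (PtPair.relPoint k)

end Fibration

/-- Serre fibrations: the homotopy lifting property for all cubes `I^n`, `n ≥ 0`. -/
def IsSerreFibration {X Y : Type u} [TopologicalSpace X] [TopologicalSpace Y] (q : C(X, Y)) :
    Prop :=
  ∀ (n : ℕ) (f : C(I^(Fin n), X)) (H : C(I × (I^(Fin n)), Y)), (∀ t, H (0, t) = q (f t)) →
    ∃ K : C(I × (I^(Fin n)), X), (∀ t, K (0, t) = f t) ∧ ∀ z, q (K z) = H z

end

end DirectedHomotopy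

open DirectedHomotopy

/-! Exactness and the comparison with the base can both be checked at a single trace `e`. There the
statement concerns the pointed pair (total trace space, fibre over `p(e)`) and the induced map to
the trace space of the base.

Exactness is that of the homotopy sequence of a pointed pair. By `exact_of_range`, once the kernel
of the second map on points is the range of the first, exactness in the sense of actions follows,
group component included. This also covers degree 1, where the relative term is only a pointed set
with an action. Each inclusion "kernel in range" is an explicit deformation of cubes. A relative
null-homotopy is swept around a square to end in the subspace
(`exists_homotopic_of_relHomotopic_const`). A null-homotopy of the distinguished face is glued on as
a collar (`exists_relHomotopic_relOfGenLoop`). A null-homotopy in the total space is itself a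
relative cube (`relLoopOfHomotopy`). At π₀ of the total space, exactness is built into the relative
term, which is defined as a cokernel.

The Serre property enters in the comparison with the base, through the lifting property for the pair
(cube, J) in `IsSerreFibration.exists_lift_jFace`. Radial projection onto J turns the relative
lifting problem into an ordinary homotopy lifting problem. Lifting a cube gives surjectivity of the
relative homotopy set onto that of (B, {b}), and lifting a homotopy, regarded as a cube one
dimension higher, gives injectivity. Cubes of the pair (B, {b}) are exactly the absolute ones, so
the target is the homotopy of the base. In degree 0, path connectedness of the base and path lifting
make both sides one-point sets. -/

namespace DirectedHomotopy

/-! ### Pointwise criteria for exactness and for isomorphisms. -/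

namespace ActCat

/-- Exactness of a sequence of actions follows from exactness of the underlying sequence of
pointed sets. -/
theorem exact_of_range {A B C : ActCat.{u}} (f : A ⟶ B) (g : B ⟶ C)
    (h : ∀ y, g.fn y = C.zero ↔ ∃ x, f.fn x = y) : Exact f g := by
  have w : ∀ x, g.fn (f.fn x) = C.zero := fun x => (h _).2 ⟨x, rfl⟩
  -- The generated equivalence relation need not be analysed: `g` factors through the cokernel, so a
  -- point that becomes zero there is already in the kernel of `g`.
  have hpts : ∀ y, (cokProj f).fn y = (cok f).zero ↔ g.fn y = C.zero := by
    intro y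
    refine ⟨fun hy => ?_, fun hy => ?_⟩
    · exact (congrArg (cokDesc f g w).fn hy).trans (cokDesc f g w).map_zero
    · obtain ⟨x, rfl⟩ := (h y).1 hy
      exact cokProj_fn_apply f x
  refine Sub.ext (Set.ext hpts) (Subgroup.ext fun k => ?_)
  -- The group components follow from the points: `k` stabilizes the zero class exactly when the
  -- point `0 · k` dies in the cokernel, and `g` sends that point to `0 · g(k)`.
  have h1 : g.fn (B.act B.zero k) = C.act C.zero (g.hom k) := by rw [g.map_act, g.map_zero]
  change (cokProj f).fn (B.act B.zero k) = (cok f).zero ↔ C.act C.zero (g.hom k) = C.zero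
  rw [hpts, h1]

theorem isIso_of_bijective {A B : ActCat.{u}} (f : A ⟶ B) (h₁ : Function.Bijective f.fn)
    (h₂ : Function.Bijective f.hom) : IsIso f := by
  let e₁ := Equiv.ofBijective f.fn h₁
  let e₂ := MulEquiv.ofBijective f.hom h₂
  refine ⟨⟨e₁.symm, e₂.symm.toMonoidHom, ?_, fun x g => ?_⟩, ?_, ?_⟩
  · exact e₁.symm_apply_eq.2 f.map_zero.symm
  · refine e₁.symm_apply_eq.2 ?_
    refine Eq.trans ?_ (f.map_act _ _).symm
    exact congrArg₂ B.act (e₁.apply_symm_apply x).symm (e₂.apply_symm_apply g).symm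
  · apply hom_ext
    · exact funext e₁.symm_apply_apply
    · exact MonoidHom.ext e₂.symm_apply_apply
  · apply hom_ext
    · exact funext e₁.apply_symm_apply
    · exact MonoidHom.ext e₂.apply_symm_apply

end ActCat

theorem Pointed.isIso_of_bijective {A B : Pointed.{u}} (f : A ⟶ B)
    (h : Function.Bijective f.toFun) : IsIso f := by
  let e := Equiv.ofBijective f.toFun h
  exact ⟨⟨e.symm, e.symm_apply_eq.2 f.map_point.symm⟩,
    Pointed.Hom.ext (funext e.symm_apply_apply), Pointed.Hom.ext (funext e.apply_symm_apply)⟩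

/-! ### The exact sequence of a pointed pair -/

namespace PtPair

variable {P : PtPair.{u}} {n : ℕ}

/-- Side faces do not see the last coordinate, so only the face opposite the distinguished one
imposes a condition. This keeps deformations along the last coordinate within maps of triples. -/
theorem update_last_mem_jFace {t : I^(Fin (n + 1))} (ht : t ∈ jFace n) {s : I}
    (hs : t (Fin.last n) = 1 → s = 1) : Function.update t (Fin.last n) s ∈ jFace n := by
  rcases ht with h | ⟨i, hi, h⟩
  · exact Or.inl (by simp [hs h])
  · exact Or.inr ⟨i, hi, by rwa [Function.update_of_ne hi]⟩

theorem continuous_update_last {Z : Type*} [TopologicalSpace Z] {f : Z → I^(Fin (n + 1))}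
    {g : Z → I} (hf : Continuous f) (hg : Continuous g) :
    Continuous fun z => Function.update (f z) (Fin.last n) (g z) :=
  hf.update _ hg

theorem mem_jFace_of_mem_boundary {t : I^(Fin (n + 1))} (ht : t ∈ Cube.boundary (Fin (n + 1)))
    (h0 : t (Fin.last n) ≠ 0) : t ∈ jFace n := by
  obtain ⟨i, hi⟩ := ht
  by_cases h : i = Fin.last n
  · subst h
    exact Or.inl (hi.resolve_left h0)
  · exact Or.inr ⟨i, h, hi⟩

theorem init_mem_boundary_of_ne {t : I^(Fin (n + 1))} {i : Fin (n + 1)} (hi : i ≠ Fin.last n)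
    (h : t i = 0 ∨ t i = 1) : Fin.init t ∈ Cube.boundary (Fin n) := by
  obtain ⟨j, rfl⟩ := Fin.exists_castSucc_eq.2 hi
  exact ⟨j, h⟩

/-- A cube in the subspace is null-homotopic as a map of triples. -/
theorem relHomotopic_const_of_mem (f : P.RelLoop n) (hf : ∀ t, f.1 t ∈ P.sub) :
    RelHomotopic f relConst := by
  -- The cube is pushed along its last coordinate into the face where that coordinate is 1, on which
  -- `f` is constant.
  have hc : Continuous fun z : I × (I^(Fin (n + 1))) => f.1 (Function.update z.2 (Fin.last n)
      (max (z.2 (Fin.last n)) z.1)) :=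
    f.1.continuous.comp (continuous_update_last continuous_snd (by fun_prop))
  refine ⟨⟨⟨⟨_, hc⟩, fun t => ?_, fun t => ?_⟩, fun s => ⟨fun t _ => hf _, fun t ht => ?_⟩⟩⟩
  · have h : max (t (Fin.last n)) 0 = t (Fin.last n) := max_eq_left (t _).2.1
    change f.1 (Function.update t _ (max _ 0)) = f.1 t
    rw [h, Function.update_eq_self]
  · have h : max (t (Fin.last n)) 1 = 1 := max_eq_right (t _).2.2
    exact f.2.2 _ (Or.inl (by simp [h]))
  · refine f.2.2 _ (update_last_mem_jFace ht fun h => ?_)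
    change max (t (Fin.last n)) s = 1
    rw [h]
    exact max_eq_left s.2.2

/-- A cube that is null-homotopic as a map of triples comes from the subspace. -/
theorem exists_homotopic_of_relHomotopic_const (f : GenLoop (Fin (n + 1)) P.carrier P.pt)
    (h : RelHomotopic (relOfGenLoop (P := P) f) relConst) :
    ∃ g : GenLoop (Fin (n + 1)) P.sub (⟨P.pt, P.pt_mem⟩ : P.sub),
      GenLoop.Homotopic f (genLoopMap ⟨Subtype.val, continuous_subtype_val⟩ rfl g) := by
  obtain ⟨H⟩ := h
  have H0 : ∀ t, H (0, t) = f t := H.apply_zero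
  have H1 : ∀ t, H (1, t) = P.pt := H.apply_one
  have HA : ∀ s t, t ∈ Cube.boundary (Fin (n + 1)) → H (s, t) ∈ P.sub := fun s => (H.prop s).1
  have HJ : ∀ s t, t ∈ jFace n → H (s, t) = P.pt := fun s => (H.prop s).2
  -- In the square with axes (time of `H`, last coordinate), the point `(α r, β r)` runs from `(0,
  -- 1)` through `(1, 1)` to `(1, 0)`, along edges where `H` is constant. `K` at stage `r` reads `H`
  -- on the segment from the origin to that point. At `r = 0` this is `f`; at `r = 1` the segment
  -- lies over the distinguished face, where `H` takes values in the subspace.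
  let α : I → I := fun r => Set.projIcc 0 1 zero_le_one (2 * (r : ℝ))
  let β : I → I := fun r => Set.projIcc 0 1 zero_le_one (2 - 2 * (r : ℝ))
  have α0 : α 0 = 0 := Set.projIcc_of_le_left _ (by simp)
  have β0 : β 0 = 1 := Set.projIcc_of_right_le _ (by simp)
  have α1 : α 1 = 1 := Set.projIcc_of_right_le _ (by simp)
  have β1 : β 1 = 0 := Set.projIcc_of_le_left _ (by simp)
  have hαβ : ∀ r, α r = 1 ∨ β r = 1 := fun r => by
    rcases le_total (1 / 2 : ℝ) r with hr | hr
    · exact Or.inl (Set.projIcc_of_right_le _ (by linarith))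
    · exact Or.inr (Set.projIcc_of_right_le _ (by linarith))
  let K : C(I × (I^(Fin (n + 1))), P.carrier) :=
    ⟨fun z => H (z.2 (Fin.last n) * α z.1,
      Function.update z.2 (Fin.last n) (z.2 (Fin.last n) * β z.1)), by
        refine H.continuous.comp (Continuous.prodMk (by fun_prop) ?_)
        exact continuous_update_last continuous_snd (by fun_prop)⟩
  have hK : ∀ r t, K (r, t) = H (t (Fin.last n) * α r,
      Function.update t (Fin.last n) (t (Fin.last n) * β r)) := fun _ _ => rfl
  have Kb : ∀ r t, t ∈ Cube.boundary (Fin (n + 1)) → K (r, t) = P.pt := by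
    rintro r t ⟨i, hi⟩
    rw [hK]
    by_cases hl : i = Fin.last n
    · subst hl
      rcases hi with hi | hi
      · rw [hi, zero_mul, zero_mul, H0]
        exact f.2 _ ⟨Fin.last n, Or.inl (by simp)⟩
      · rw [hi, one_mul, one_mul]
        rcases hαβ r with h | h
        · rw [h, H1]
        · exact HJ _ _ (Or.inl (by simp [h]))
    · exact HJ _ _ (Or.inr ⟨i, hl, by rwa [Function.update_of_ne hl]⟩)
  have KA : ∀ t, K (1, t) ∈ P.sub := fun t => by
    rw [hK, β1, mul_zero]
    exact HA _ _ ⟨Fin.last n, Or.inl (by simp)⟩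
  refine ⟨⟨⟨fun t => ⟨K (1, t), KA t⟩, by fun_prop⟩, fun t ht => Subtype.ext (Kb 1 t ht)⟩,
    ⟨⟨⟨K, fun t => ?_, fun t => rfl⟩, fun s t ht => ?_⟩⟩⟩
  · change K (0, t) = f t
    rw [hK, α0, β0, mul_zero, mul_one, Function.update_eq_self, H0]
  · exact (Kb s t ht).trans (f.2 t ht).symm

/-- A map of triples whose distinguished face is null-homotopic in the subspace comes from a cube
whose boundary is sent to the base point. -/
theorem exists_relHomotopic_relOfGenLoop (f : P.RelLoop n) (N : C(I × (I^(Fin n)), P.carrier))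
    (NA : ∀ z, N z ∈ P.sub) (N0 : ∀ t, N (0, t) = f.1 (Fin.snoc t 0)) (N1 : ∀ t, N (1, t) = P.pt)
    (Nb : ∀ s, ∀ t ∈ Cube.boundary (Fin n), N (s, t) = P.pt) :
    ∃ g : GenLoop (Fin (n + 1)) P.carrier P.pt, RelHomotopic f (relOfGenLoop g) := by
  let pr : ℝ → I := Set.projIcc 0 1 zero_le_one
  have hpr : Continuous pr := continuous_projIcc
  -- At stage `s` the last coordinate is stretched affinely from `[0, 1]` onto `[-s, 1]`. The
  -- nonnegative part carries `f`, and the negative part is a collar carrying `N` at time `-v`. The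
  -- new distinguished face is `N` at time `s`, so it stays in the subspace and is constant at `s =
  -- 1`.
  let v : I × (I^(Fin (n + 1))) → ℝ := fun z =>
    -(z.1 : ℝ) + (z.2 (Fin.last n) : ℝ) * (1 + (z.1 : ℝ))
  have hv : Continuous v := by fun_prop
  have hinit : Continuous fun z : I × (I^(Fin (n + 1))) => (Fin.init z.2 : I^(Fin n)) :=
    continuous_pi fun i => (continuous_apply _).comp continuous_snd
  let Φ : I × (I^(Fin (n + 1))) → P.carrier := fun z =>
    if 0 ≤ v z then f.1 (Function.update z.2 (Fin.last n) (pr (v z)))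
    else N (pr (-(v z)), Fin.init z.2)
  have pr0 : pr 0 = 0 := Set.projIcc_left zero_le_one
  have hΦ : Continuous Φ := by
    refine Continuous.if_le ?_ ?_ continuous_const hv ?_
    · exact f.1.continuous.comp (continuous_update_last continuous_snd (hpr.comp hv))
    · exact N.continuous.comp ((hpr.comp hv.neg).prodMk hinit)
    · intro z hz
      rw [← hz, neg_zero, pr0, N0]
      congr 1
      nth_rewrite 1 [← Fin.snoc_init_self z.2]
      exact Fin.update_snoc_last (α := fun _ => I) ..
  have ΦJ : ∀ s, ∀ t ∈ jFace n, Φ (s, t) = P.pt := by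
    intro s t ht
    change (if _ then _ else _) = _
    split_ifs with h
    · refine f.2.2 _ (update_last_mem_jFace ht fun h1 => ?_)
      exact Set.projIcc_of_right_le _ (by simp [v, h1])
    · rcases ht with h1 | ⟨i, hi, h1⟩
      · exact absurd (by simp [v, h1]) h
      · exact Nb _ _ (init_mem_boundary_of_ne hi h1)
  have Φl : ∀ s t, t (Fin.last n) = 0 → Φ (s, t) = N (s, Fin.init t) := by
    intro s t ht
    have hv' : v (s, t) = -s := by simp [v, ht]
    change (if _ then _ else _) = _
    rw [hv', neg_neg]
    have hs : pr s = s := Set.projIcc_val _ s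
    split_ifs with h
    · have h0 : s = 0 := le_antisymm (Subtype.coe_le_coe.1 (by simpa using h)) s.2.1
      rw [h0, N0]
      simp only [Set.Icc.coe_zero, neg_zero, pr0]
      congr 1
      nth_rewrite 1 [← Fin.snoc_init_self t]
      exact Fin.update_snoc_last (α := fun _ => I) ..
    · rw [hs]
  have Φb : ∀ s, ∀ t ∈ Cube.boundary (Fin (n + 1)), Φ (s, t) ∈ P.sub := by
    intro s t ht
    by_cases h0 : t (Fin.last n) = 0
    · rw [Φl s t h0]
      exact NA _
    · rw [ΦJ s t (mem_jFace_of_mem_boundary ht h0)]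
      exact P.pt_mem
  refine ⟨⟨⟨fun t => Φ (1, t), by fun_prop⟩, fun t ht => ?_⟩,
    ⟨⟨⟨⟨Φ, hΦ⟩, fun t => ?_, fun t => rfl⟩, fun s => ⟨Φb s, ΦJ s⟩⟩⟩⟩
  · change Φ (1, t) = P.pt
    by_cases h0 : t (Fin.last n) = 0
    · rw [Φl 1 t h0, N1]
    · exact ΦJ 1 t (mem_jFace_of_mem_boundary ht h0)
  · have hv' : v (0, t) = t (Fin.last n) := by simp [v]
    change (if _ then _ else _) = _
    rw [hv', if_pos (t (Fin.last n)).2.1]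
    have hs : pr (t (Fin.last n)) = t (Fin.last n) := Set.projIcc_val _ _
    rw [hs, Function.update_eq_self]

/-- A homotopy from a family of points of the subspace to the constant map, as a map of
triples. -/
def relLoopOfHomotopy (H : C(I × (I^(Fin n)), P.carrier)) (H0 : ∀ t, H (0, t) ∈ P.sub)
    (H1 : ∀ t, H (1, t) = P.pt) (Hb : ∀ s, ∀ t ∈ Cube.boundary (Fin n), H (s, t) = P.pt) :
    P.RelLoop n :=
  have hJ : ∀ t ∈ jFace n, H (t (Fin.last n), Fin.init t) = P.pt := by
    rintro t (h | ⟨i, hi, h⟩)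
    · rw [h, H1]
    · exact Hb _ _ (init_mem_boundary_of_ne hi h)
  ⟨⟨fun t => H (t (Fin.last n), Fin.init t), H.continuous.comp
      ((continuous_apply _).prodMk (continuous_pi fun i => continuous_apply _))⟩,
    fun t ht => by
      by_cases h0 : t (Fin.last n) = 0
      · change H (t (Fin.last n), Fin.init t) ∈ P.sub
        rw [h0]
        exact H0 _
      · change H (t (Fin.last n), Fin.init t) ∈ P.sub
        rw [hJ t (mem_jFace_of_mem_boundary ht h0)]
        exact P.pt_mem, hJ⟩

end PtPair

/-! ### Serre fibrations -/

section Serre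

variable {X Y : Type u} [TopologicalSpace X] [TopologicalSpace Y]

/-- The lifting property of Serre fibrations for the pair `(I^(n+1), J)`. -/
theorem IsSerreFibration.exists_lift_jFace {q : C(X, Y)} (hq : IsSerreFibration q) {n : ℕ}
    (c : C(I^(Fin (n + 1)), X)) (F : C(I^(Fin (n + 1)), Y))
    (h : ∀ t ∈ PtPair.jFace n, F t = q (c t)) :
    ∃ G : C(I^(Fin (n + 1)), X), (∀ t, q (G t) = F t) ∧ ∀ t ∈ PtPair.jFace n, G t = c t := by
  -- `M` measures the size of `t` as seen from the centre `(1/2, …, 1/2, -1)`: dividing the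
  -- displacement from that centre by `M` lands on J, and `M = 1` on J itself. It is at least `1/2`,
  -- so the division is safe.
  let S : (I^(Fin (n + 1))) → Fin n → ℝ := fun t i => 2 * (t i.castSucc : ℝ) - 1
  let M : (I^(Fin (n + 1))) → ℝ := fun t => max (((t (Fin.last n) : ℝ) + 1) / 2) ‖S t‖
  have hS : Continuous S := by fun_prop
  have hM : Continuous M := by fun_prop
  have hS1 : ∀ t i, |S t i| ≤ 1 := fun t i => by
    have h0 := (t i.castSucc).2.1
    have h1 := (t i.castSucc).2.2
    rw [abs_le]
    constructor <;> simp only [S] <;> linarith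
  have hM1 : ∀ t, M t ≤ 1 := fun t => max_le (by linarith [(t (Fin.last n)).2.2])
    ((pi_norm_le_iff_of_nonneg zero_le_one).2 (hS1 t))
  have hMpos : ∀ t, 0 < M t := fun t =>
    lt_of_lt_of_le (by linarith [(t (Fin.last n)).2.1]) (le_max_left _ _)
  let u : (I^(Fin (n + 1))) → I := fun t => ⟨1 - M t, by linarith [hM1 t], by linarith [hMpos t]⟩
  have hu : Continuous u := by fun_prop
  -- the radial motion away from the point `(1/2, …, 1/2, -1)`
  let pr : ℝ → I := Set.projIcc 0 1 zero_le_one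
  have hpr : Continuous pr := continuous_projIcc
  have prv : ∀ x : I, pr x = x := Set.projIcc_val _
  let ρ : I × (I^(Fin (n + 1))) → (I^(Fin (n + 1))) := fun z =>
    Fin.snoc (fun i => pr (1 / 2 + S z.2 i / 2 / (M z.2 + z.1)))
      (pr (-1 + ((z.2 (Fin.last n) : ℝ) + 1) / (M z.2 + z.1)))
  have hne : ∀ z : I × (I^(Fin (n + 1))), M z.2 + z.1 ≠ 0 := fun z =>
    (add_pos_of_pos_of_nonneg (hMpos z.2) z.1.2.1).ne'
  have hden : Continuous fun z : I × (I^(Fin (n + 1))) => M z.2 + (z.1 : ℝ) := by fun_prop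
  have hρ : Continuous ρ := by
    refine Continuous.finSnoc (A := fun _ => I) (continuous_pi fun i => hpr.comp ?_) (hpr.comp ?_)
    · refine continuous_const.add (Continuous.div ?_ hden hne)
      exact (((continuous_apply i).comp hS).comp continuous_snd).div_const 2
    · exact continuous_const.add (Continuous.div (by fun_prop) hden hne)
  -- At time `u t = 1 - M t` the scale factor is 1, and the clamping by `pr` is inactive. Clamping
  -- only makes `ρ` land in the cube at later times, which are never used.
  have ρu : ∀ t, ρ (u t, t) = t := by
    intro t
    have h1 : M t + (u t : ℝ) = 1 := by simp [u]
    refine Eq.trans ?_ (Fin.snoc_init_self t)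
    refine congrArg₂ (Fin.snoc (α := fun _ => I)) (funext fun i => ?_) ?_
    · rw [h1, ← prv (Fin.init t i)]
      congr 1
      simp only [S, Fin.init]
      ring
    · rw [h1, ← prv (t (Fin.last n))]
      congr 1
      ring
  have ρ0 : ∀ t, ρ (0, t) ∈ PtPair.jFace n := by
    intro t
    have hz : M t + ((0 : I) : ℝ) = M t := by simp
    -- Whichever term attains the maximum decides which face the ray hits: the height gives the face
    -- where the last coordinate is 1, the norm gives a side face at a coordinate where the sup norm
    -- is attained.
    rcases max_choice (((t (Fin.last n) : ℝ) + 1) / 2) ‖S t‖ with h1 | h1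
    · left
      refine (Fin.snoc_last (α := fun _ => I) ..).trans ?_
      rw [hz]
      refine Set.projIcc_of_right_le _ ?_
      have h2 : ((t (Fin.last n) : ℝ) + 1) / M t = 2 := by
        rw [div_eq_iff (hMpos t).ne']
        change M t = _ at h1
        linarith
      rw [h2]
      norm_num
    · right
      have hpos : 0 < ‖S t‖ := h1 ▸ hMpos t
      obtain ⟨i, hi⟩ : ∃ i, ‖S t i‖ = ‖S t‖ := by
        by_contra! hcon
        exact lt_irrefl _ ((pi_norm_lt_iff hpos).2 fun i =>
          lt_of_le_of_ne (norm_le_pi_norm _ i) (hcon i))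
      refine ⟨i.castSucc, (Fin.castSucc_lt_last i).ne, ?_⟩
      have hi' : ρ (0, t) i.castSucc = pr (1 / 2 + S t i / 2 / M t) := by
        refine (Fin.snoc_castSucc (α := fun _ => I) ..).trans ?_
        rw [hz]
      have hMi : M t = |S t i| := h1.trans hi.symm
      have hM0 := (hMpos t).ne'
      rw [hi']
      rcases abs_choice (S t i) with h2 | h2
      · right
        refine Set.projIcc_of_right_le _ ?_
        have : S t i / 2 / M t = 1 / 2 := by
          rw [show S t i = M t by rw [hMi, h2]]; field_simp
        rw [this]
        norm_num
      · left
        refine Set.projIcc_of_le_left _ ?_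
        have : S t i / 2 / M t = -(1 / 2) := by
          rw [show S t i = -M t by rw [hMi, h2, neg_neg]]; field_simp
        rw [this]
        norm_num
  have uJ : ∀ t ∈ PtPair.jFace n, u t = 0 := by
    intro t ht
    suffices h1 : 1 ≤ M t from Subtype.ext (by
      change 1 - M t = 0
      linarith [hM1 t])
    rcases ht with h1 | ⟨i, hi, h1⟩
    · refine le_trans ?_ (le_max_left _ _)
      rw [h1]
      norm_num
    · obtain ⟨j, rfl⟩ := Fin.exists_castSucc_eq.2 hi
      refine le_trans ?_ ((norm_le_pi_norm (S t) j).trans (le_max_right _ _))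
      rcases h1 with h1 | h1 <;> norm_num [S, h1]
  -- The homotopy `F ∘ ρ` starts on J, where `c` provides a lift. Its lift, read at time `u t`, lies
  -- over `F t`; on J this time is 0 and `ρ` fixes the point, so the value is `c t`.
  obtain ⟨K, hK0, hK⟩ := hq (n + 1) ⟨fun t => c (ρ (0, t)), by fun_prop⟩
    ⟨fun z => F (ρ z), by fun_prop⟩ (fun t => h _ (ρ0 t))
  refine ⟨⟨fun t => K (u t, t), by fun_prop⟩, fun t => ?_, fun t ht => ?_⟩
  · exact (hK _).trans (congrArg F (ρu t))
  · have h1 := ρu t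
    rw [uJ t ht] at h1
    change K (u t, t) = c t
    rw [uJ t ht, hK0]
    exact congrArg c h1

end Serre

/-! ### Relative homotopy of a fibration and homotopy of the base. -/

namespace PtPair

variable {P : PtPair.{u}} {B : PtTop.{u}} (φ : P ⟶ ofPtTop.obj B)

/-- Lift the cube with constant value on J. Its boundary lies over the base point, hence in the
subspace, which contains the whole fibre. -/
theorem map_surjective_of_isSerreFibration (hφ : IsSerreFibration φ.toMap)
    (hsub : ∀ x, φ.toMap x = B.pt → x ∈ P.sub) (n : ℕ) :
    Function.Surjective (RelPi.map (n := n) φ) := by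
  intro a
  induction a using RelPi.ind with | h f => ?_
  obtain ⟨G, hG, hJ⟩ := hφ.exists_lift_jFace (ContinuousMap.const _ P.pt) f.1
    (fun t ht => (f.2.2 t ht).trans φ.map_pt.symm)
  refine ⟨RelPi.mk ⟨G, fun t ht => hsub _ ((hG t).trans (f.2.1 t ht)), hJ⟩, ?_⟩
  rw [RelPi.map_mk]
  exact congrArg RelPi.mk (Subtype.ext (ContinuousMap.ext hG))

/-- A homotopy in the base is a cube with time as coordinate 0. Its lift is prescribed on J: `f` and
`g` at the two ends of time, the base point on the remaining faces. -/
theorem map_injective_of_isSerreFibration (hφ : IsSerreFibration φ.toMap)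
    (hsub : ∀ x, φ.toMap x = B.pt → x ∈ P.sub) (n : ℕ) :
    Function.Injective (RelPi.map (n := n) φ) := by
  intro a b hab
  induction a using RelPi.ind with | h f => ?_
  induction b using RelPi.ind with | h g => ?_
  rw [RelPi.map_mk, RelPi.map_mk] at hab
  obtain ⟨H⟩ : RelHomotopic (relLoopMap φ f) (relLoopMap φ g) := Quotient.exact hab
  let tl : (I^(Fin (n + 2))) → (I^(Fin (n + 1))) := Fin.tail
  have htail : Continuous tl := continuous_pi fun i => continuous_apply _
  let pr : ℝ → I := Set.projIcc 0 1 zero_le_one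
  have hpr : Continuous pr := continuous_projIcc
  -- `exists_lift_jFace` asks for a map `c` on the whole cube, so the data on J must be extended.
  -- `c₀` pushes `k` towards the face where it is constant, to an extent given by `a`.
  let c₀ : RelLoop P n → (I → ℝ) → (I^(Fin (n + 2))) → P.carrier := fun k a t =>
    k.1 (Function.update (tl t) (Fin.last n) (max (tl t (Fin.last n)) (pr (a (t 0)))))
  have hc₀ : ∀ k a, Continuous a → Continuous (c₀ k a) := fun k a ha => by
    refine k.1.continuous.comp (continuous_update_last htail (Continuous.max ?_ ?_))
    · exact (continuous_apply (Fin.last n)).comp htail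
    · exact hpr.comp (ha.comp (continuous_apply 0))
  have c₀J : ∀ k a t, tl t ∈ jFace n → c₀ k a t = P.pt := fun k a t ht => by
    refine k.2.2 _ (update_last_mem_jFace ht fun h => ?_)
    exact (congrArg (max · _) h).trans (max_eq_left (pr _).2.2)
  have c₀1 : ∀ k a t, 1 ≤ a (t 0) → c₀ k a t = P.pt := fun k a t ht => by
    refine k.2.2 _ (Or.inl ?_)
    rw [Function.update_self, show pr (a (t 0)) = 1 from Set.projIcc_of_right_le _ ht]
    exact max_eq_right (tl t _).2.2
  have c₀0 : ∀ k a t, a (t 0) ≤ 0 → c₀ k a t = k.1 (tl t) := fun k a t ht => by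
    have h : max (tl t (Fin.last n)) (pr (a (t 0))) = tl t (Fin.last n) := by
      rw [show pr (a (t 0)) = 0 from Set.projIcc_of_le_left _ ht]
      exact max_eq_left (tl t _).2.1
    change k.1 (Function.update _ _ (max _ _)) = _
    rw [h, Function.update_eq_self]
  let a₁ : I → ℝ := fun s => 2 * (s : ℝ)
  let a₂ : I → ℝ := fun s => 2 - 2 * (s : ℝ)
  have ha₁ : Continuous a₁ := by fun_prop
  have ha₂ : Continuous a₂ := by fun_prop
  -- `f` is contracted to the base point in the first half of time and `g` is expanded from it in
  -- the second. Away from J, this map need not lie over `H`.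
  let c : (I^(Fin (n + 2))) → P.carrier := fun t =>
    if (t 0 : ℝ) ≤ 1 / 2 then c₀ f a₁ t else c₀ g a₂ t
  have hc : Continuous c := by
    refine Continuous.if_le (hc₀ f _ ha₁) (hc₀ g _ ha₂) (by fun_prop)
      continuous_const fun t ht => ?_
    rw [c₀1 f _ t (by norm_num [a₁, a₂, ht]), c₀1 g _ t (by norm_num [a₁, a₂, ht])]
  have c0 : ∀ t, t 0 = 0 → c t = f.1 (tl t) := fun t ht =>
    (if_pos (by simp [ht])).trans (c₀0 _ _ _ (by simp [a₁, ht]))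
  have c1 : ∀ t, t 0 = 1 → c t = g.1 (tl t) := fun t ht =>
    (if_neg (by norm_num [ht])).trans (c₀0 _ _ _ (by simp [a₂, ht]))
  have cJ : ∀ t, tl t ∈ jFace n → c t = P.pt := fun t ht => by
    change (if _ then _ else _) = _
    split_ifs
    · exact c₀J _ _ _ ht
    · exact c₀J _ _ _ ht
  obtain ⟨G, hG, hGJ⟩ := hφ.exists_lift_jFace ⟨c, hc⟩
    ⟨fun t => H (t 0, tl t), H.continuous.comp ((continuous_apply 0).prodMk htail)⟩ (by
      intro t ht
      change H (t 0, tl t) = φ.toMap (c t)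
      rw [← Fin.cons_self_tail t] at ht
      rcases mem_jFace_cons.1 ht with (h | h) | h
      · rw [c0 t h, h]
        exact H.apply_zero _
      · rw [c1 t h, h]
        exact H.apply_one _
      · rw [cJ t h, φ.map_pt]
        exact (H.prop _).2 _ h)
  have hGc : ∀ s t, (s = 0 ∨ s = 1) ∨ t ∈ jFace n → G (Fin.cons s t) = c (Fin.cons s t) :=
    fun s t h => hGJ _ (mem_jFace_cons.2 h)
  refine RelPi.sound ⟨⟨⟨⟨fun z => G (Fin.cons z.1 z.2), G.continuous.comp
    (Continuous.finCons (A := fun _ => I) continuous_fst continuous_snd)⟩, fun t => ?_,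
    fun t => ?_⟩, fun s => ⟨fun t ht => hsub _ ?_, fun t ht => ?_⟩⟩⟩
  · exact (hGc 0 t (Or.inl (Or.inl rfl))).trans (c0 _ rfl)
  · exact (hGc 1 t (Or.inl (Or.inr rfl))).trans (c1 _ rfl)
  · exact (hG _).trans ((H.prop s).1 t ht)
  · exact (hGc s t (Or.inr ht)).trans (cJ _ ht)

/-- This composite is the map on points underlying `relToBase` in every positive degree. -/
theorem piOfRel_map_bijective (hφ : IsSerreFibration φ.toMap)
    (hsub : ∀ x, φ.toMap x = B.pt → x ∈ P.sub) (n : ℕ) :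
    Function.Bijective fun a : P.RelPi n => piOfRel (RelPi.map φ a) := by
  refine Function.Bijective.comp (g := piOfRel) ?_
    ⟨map_injective_of_isSerreFibration φ hφ hsub n, map_surjective_of_isSerreFibration φ hφ hsub n⟩
  exact ⟨Function.LeftInverse.injective relOfPi_piOfRel,
    Function.RightInverse.surjective piOfRel_relOfPi⟩

end PtPair

/-! ### Exactness at each term of the sequence of a pair. -/

namespace PtPair

variable {n : ℕ} (P : PtPair.{u})

theorem relOfPi_eq_iff (a : PiGrp n P.carrier P.pt) :
    (relOfPi a : P.RelPi n) = RelPi.mk relConst ↔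
      ∃ x, PiGrp.map (incl.app P).toMap (incl.app P).map_pt x = a := by
  induction a using PiGrp.ind with | h f => ?_
  constructor
  · intro h
    obtain ⟨g, hg⟩ := exists_homotopic_of_relHomotopic_const f (Quotient.exact h)
    exact ⟨PiGrp.mk g, (PiGrp.mk_eq.2 hg).symm⟩
  · rintro ⟨x, hx⟩
    rw [← hx]
    induction x using PiGrp.ind with | h g => ?_
    exact RelPi.sound (relHomotopic_const_of_mem _ fun t => (g t).2)

/-- A null-homotopy of the face is exactly the collar needed to make the cube absolute. Conversely,
the distinguished face of an absolute cube is constant. -/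
theorem boundaryHom_eq_one_iff (a : P.RelPi (n + 1)) :
    boundaryHom a = 1 ↔ ∃ x, relOfPi x = a := by
  constructor
  · induction a using RelPi.ind with | h f => ?_
    intro h
    obtain ⟨N⟩ : GenLoop.Homotopic (faceLoop f) GenLoop.const := PiGrp.mk_eq.1 h
    obtain ⟨g, hg⟩ := exists_relHomotopic_relOfGenLoop f
      ⟨fun z => (N z : P.carrier), by fun_prop⟩ (fun z => (N z).2)
      (fun t => congrArg Subtype.val (N.apply_zero t))
      (fun t => congrArg Subtype.val (N.apply_one t))
      (fun s t ht => congrArg Subtype.val ((N.eq_fst s ht).trans ((faceLoop f).2 t ht)))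
    exact ⟨PiGrp.mk g, (RelPi.sound hg).symm⟩
  · rintro ⟨x, rfl⟩
    induction x using PiGrp.ind with | h g => ?_
    refine congrArg PiGrp.mk (GenLoop.ext _ _ fun t => Subtype.ext ?_)
    exact g.2 _ ⟨Fin.last _, Or.inl (by simp)⟩

/-- The same collar argument with `I^0` as the face: a path in the subspace plays the role of the
null-homotopy, and the boundary condition is vacuous. -/
theorem boundaryZero_eq_iff (a : P.RelPi 0) :
    boundaryZero a = ZerothHomotopy.mk ⟨P.pt, P.pt_mem⟩ ↔ ∃ x, relOfPi x = a := by
  constructor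
  · induction a using RelPi.ind with | h f => ?_
    intro h
    obtain ⟨γ⟩ : Joined _ _ := Quotient.exact h
    obtain ⟨g, hg⟩ := exists_relHomotopic_relOfGenLoop f
      ⟨fun z => (γ z.1 : P.carrier), by fun_prop⟩ (fun z => (γ z.1).2)
      (fun t => (congrArg Subtype.val γ.source).trans
        (congrArg f.1 (funext fun i => by rw [fin_one_eq i]; rfl)))
      (fun t => congrArg Subtype.val γ.target)
      (fun s t ht => ht.elim fun i => i.elim0)
    exact ⟨PiGrp.mk g, (RelPi.sound hg).symm⟩
  · rintro ⟨x, rfl⟩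
    induction x using PiGrp.ind with | h g => ?_
    exact congrArg ZerothHomotopy.mk (Subtype.ext (g.2 _ ⟨0, Or.inl rfl⟩))

/-- A null-homotopy in the total space and a relative cube with the given face are the same data,
the last coordinate being time. -/
theorem piMap_incl_eq_one_iff (a : PiGrp n P.sub (⟨P.pt, P.pt_mem⟩ : P.sub)) :
    PiGrp.map (incl.app P).toMap (incl.app P).map_pt a = 1 ↔
      ∃ x : P.RelPi (n + 1), boundaryHom x = a := by
  constructor
  · induction a using PiGrp.ind with | h g => ?_
    intro h
    obtain ⟨H⟩ := PiGrp.mk_eq.1 h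
    let K : C(I × (I^(Fin (n + 1))), P.carrier) := H.toContinuousMap
    have H0 : ∀ t, K (0, t) = (g t : P.sub).1 := H.apply_zero
    refine ⟨RelPi.mk (relLoopOfHomotopy K (fun t => ?_) H.apply_one
      fun s t ht => (H.eq_fst s ht).trans (congrArg Subtype.val (g.2 t ht))), ?_⟩
    · exact (H0 t).symm ▸ (g t).2
    · refine congrArg PiGrp.mk (GenLoop.ext _ _ fun t => Subtype.ext ?_)
      change K (Fin.snoc (α := fun _ => I) t 0 (Fin.last _),
        Fin.init (Fin.snoc (α := fun _ => I) t 0)) = (g t : P.sub).1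
      rw [Fin.snoc_last, Fin.init_snoc, H0]
  · rintro ⟨x, rfl⟩
    induction x using RelPi.ind with | h f => ?_
    refine PiGrp.mk_eq.2 ⟨⟨⟨⟨fun z => f.1 (Fin.snoc z.2 z.1), f.1.continuous.comp
      (Continuous.finSnoc (A := fun _ => I) continuous_snd continuous_fst)⟩, fun t => rfl,
      fun t => f.2.2 _ (Or.inl (by simp))⟩, fun s t ht => ?_⟩⟩
    obtain ⟨i, hi⟩ := ht
    have h : ∀ s : I, f.1 (Fin.snoc t s) = P.pt := fun s =>
      f.2.2 _ (Or.inr ⟨i.castSucc, (Fin.castSucc_lt_last i).ne, by simpa using hi⟩)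
    exact (h s).trans (h 0).symm

theorem pi0Map_incl_eq_iff (a : ZerothHomotopy P.sub) :
    pi0Map (incl.app P).toMap a = ZerothHomotopy.mk P.pt ↔
      ∃ x : P.RelPi 0, boundaryZero x = a := by
  constructor
  · obtain ⟨a⟩ := a
    intro h
    obtain ⟨γ⟩ : Joined (a : P.carrier) P.pt := Quotient.exact h
    exact ⟨RelPi.mk (ofPath a.2 γ), congrArg ZerothHomotopy.mk (Subtype.ext γ.source)⟩
  · rintro ⟨x, rfl⟩
    induction x using RelPi.ind with | h f => ?_
    exact Quotient.sound ⟨toPath f⟩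

theorem exact_inclMap_toRel : ∀ k, ActCat.Exact ((inclMap k).app P) ((toRel k).app P)
  -- Here `toRel` is the projection onto the cokernel of `inclMap`, so both sides are the normal
  -- image by definition.
  | 0 => rfl
  | 1 => ActCat.exact_of_range _ _ (relOfPi_eq_iff P)
  | _ + 2 => ActCat.exact_of_range _ _ (relOfPi_eq_iff P)

theorem exact_toRel_boundaryMap : ∀ k, ActCat.Exact ((toRel (k + 1)).app P) ((boundaryMap k).app P)
  | 0 => ActCat.exact_of_range _ _ (boundaryZero_eq_iff P)
  | _ + 1 => ActCat.exact_of_range _ _ (boundaryHom_eq_one_iff P)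

theorem exact_boundaryMap_inclMap : ∀ k, ActCat.Exact ((boundaryMap k).app P) ((inclMap k).app P)
  | 0 => ActCat.exact_of_range _ _ (pi0Map_incl_eq_iff P)
  | _ + 1 => ActCat.exact_of_range _ _ (piMap_incl_eq_one_iff P)

theorem exact_toRel_toNull : ActCat.Exact ((toRel 0).app P) (ActCat.toNull ((relFun 0).obj P)) := by
  refine ActCat.exact_of_range _ _ fun y => ⟨fun _ => ?_, fun _ => rfl⟩
  obtain ⟨y⟩ := y
  exact ⟨y, rfl⟩

theorem relFun_zero_subsingleton (h : ∀ x, ∃ a ∈ P.sub, Joined x a) :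
    Subsingleton ((relFun 0).obj P).pts := by
  refine subsingleton_of_forall_eq ((relFun 0).obj P).zero fun y => ?_
  obtain ⟨⟨x⟩⟩ := y
  obtain ⟨a, ha, hxa⟩ := h x
  have hx : ZerothHomotopy.mk x = ZerothHomotopy.mk a := Quotient.sound hxa
  refine (congrArg (Quot.mk _) hx).trans ?_
  exact ActCat.cokProj_fn_apply ((piFun 0).map (incl.app P)) (ZerothHomotopy.mk ⟨a, ha⟩)

end PtPair

/-- Path lifting: this is homotopy lifting for the cube `I^0`. -/
theorem IsSerreFibration.exists_joined {X Y : Type u} [TopologicalSpace X] [TopologicalSpace Y]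
    {q : C(X, Y)} (hq : IsSerreFibration q) (x : X) {y : Y} (h : Joined (q x) y) :
    ∃ a, q a = y ∧ Joined x a := by
  obtain ⟨γ⟩ := h
  obtain ⟨K, hK0, hK⟩ := hq 0 (ContinuousMap.const _ x) ⟨fun z => γ z.1, by fun_prop⟩
    (fun _ => γ.source)
  refine ⟨K (1, fun _ => 0), (hK _).trans γ.target, ⟨⟨⟨fun s => K (s, fun _ => 0), by fun_prop⟩, ?_,
    rfl⟩⟩⟩
  exact hK0 _

/-! ### Isomorphisms of natural systems with the homotopy of the base. -/

section Fibration

variable {E B : Dispace.{u}} (p : E.Hom B)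

theorem relToBase_add_two_isIso
    (hp : ∀ e : FactCat (TraceCat E), IsSerreFibration (p.traceMap e.src.pt e.tgt.pt)) (k : ℕ) :
    IsIso (relToBase p (k + 2)) := by
  have : ∀ e, IsIso ((relToBase p (k + 2)).app e) := fun e => by
    -- The subspace is by definition the whole fibre over `p(e)`. In these degrees groups act on
    -- themselves, so the one bijection serves both as the map on points and as the homomorphism.
    have h := PtPair.piOfRel_map_bijective ((fibrePairMap p).app e) (hp e) (fun _ h => h) (k + 1)
    exact ActCat.isIso_of_bijective _ h h
  exact NatIso.isIso_of_isIso_app _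

/-- Only points are compared: the group component is the map of fundamental groups from the total
space to the base, which need not be bijective. -/
theorem relToBase_one_points_isIso
    (hp : ∀ e : FactCat (TraceCat E), IsSerreFibration (p.traceMap e.src.pt e.tgt.pt)) :
    IsIso (Functor.whiskerRight (relToBase p 1) ActCat.points) := by
  have : ∀ e, IsIso ((Functor.whiskerRight (relToBase p 1) ActCat.points).app e) := fun e =>
    Pointed.isIso_of_bijective _
      (PtPair.piOfRel_map_bijective ((fibrePairMap p).app e) (hp e) (fun _ h => h) 0)
  exact NatIso.isIso_of_isIso_app _

/-- A path in the base from the image of a trace to `p(e)` lifts, so every trace is joined to the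
fibre and the relative π₀ is a point, like π₀ of the base. The acting groups are trivial. -/
theorem relToBase_zero_isIso
    (hp : ∀ e : FactCat (TraceCat E), IsSerreFibration (p.traceMap e.src.pt e.tgt.pt))
    (hB : ∀ e : FactCat (TraceCat E),
      PathConnectedSpace (B.Trace (p.toMap e.src.pt) (p.toMap e.tgt.pt))) :
    IsIso (relToBase p 0) := by
  have : ∀ e, IsIso ((relToBase p 0).app e) := fun e => by
    have := hB e
    have h₁ : Subsingleton ((relHtpy p 0).obj e).pts :=
      PtPair.relFun_zero_subsingleton ((fibrePair p).obj e) fun x =>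
        (hp e).exists_joined x (PathConnectedSpace.joined _ _)
    have h₂ : Subsingleton ((pullHtpy p 0).obj e).pts :=
      inferInstanceAs (Subsingleton (ZerothHomotopy (B.Trace (p.toMap e.src.pt) (p.toMap e.tgt.pt))))
    refine ActCat.isIso_of_bijective _
      ⟨fun _ _ _ => h₁.elim _ _, fun y => ⟨((relHtpy p 0).obj e).zero, h₂.elim _ _⟩⟩ ?_
    exact ⟨fun _ _ _ => rfl, fun y => ⟨PUnit.unit, rfl⟩⟩
  exact NatIso.isIso_of_isIso_app _

end Fibration

end DirectedHomotopy

theorem mainTheorem4 {E B : Dispace.{u}} (p : E.Hom B)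
    (hp : ∀ e : FactCat (TraceCat E), IsSerreFibration (p.traceMap e.src.pt e.tgt.pt)) :
    ((∀ k : ℕ, NatSys.Exact (fibToTotal p k) (totalToRel p k)) ∧
      (∀ k : ℕ, NatSys.Exact (totalToRel p (k + 1)) (relToFib p k)) ∧
      (∀ k : ℕ, NatSys.Exact (relToFib p k) (fibToTotal p k)) ∧
      NatSys.Exact (totalToRel p 0) (NatSys.toNull (relHtpy p 0))) ∧
    (∀ k : ℕ, 2 ≤ k → IsIso (relToBase p k)) ∧
    IsIso (Functor.whiskerRight (relToBase p 1) ActCat.points) ∧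
    ((∀ e : FactCat (TraceCat E),
        PathConnectedSpace (B.Trace (p.toMap e.src.pt) (p.toMap e.tgt.pt))) →
      IsIso (relToBase p 0)) := by
  -- The index `k` is the homotopy degree, so it stands for `n = k + 1`: the ranges `k ≥ 2`, `k =
  -- 1`, `k = 0` are `n ≥ 3`, `n = 2`, `n = 1`.
  refine ⟨⟨fun k e => ?_, fun k e => ?_, fun k e => ?_, fun e => ?_⟩, fun k hk => ?_, ?_, ?_⟩
  · exact PtPair.exact_inclMap_toRel ((fibrePair p).obj e) k
  · exact PtPair.exact_toRel_boundaryMap ((fibrePair p).obj e) k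
  · exact PtPair.exact_boundaryMap_inclMap ((fibrePair p).obj e) k
  · exact PtPair.exact_toRel_toNull ((fibrePair p).obj e)
  · obtain ⟨k, rfl⟩ := Nat.exists_eq_add_of_le' hk
    exact relToBase_add_two_isIso p hp k
  · exact relToBase_one_points_isIso p hp
  · exact relToBase_zero_isIso p hp
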